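/- Let $m\ge 1$, $n\ge 1$, $k\ge 2$ be integers, $\varepsilon\in\{1,-1\}$ and $i\in\{1,\dots,m\}$. An $m$-component virtual string link diagram (components ordered and oriented) is considered up to planar isotopy and virtual moves, i.e. it is given by its Gauss diagram: each classical crossing is a signed arrow from the overpass (tail) to the underpass (head). A welded string link is a class of such diagrams under the welded Reidemeister moves (R1–R3, the virtual moves, and the overcrossings commute move OC). The $(2n+\mathrm{sv})$-equivalence is the equivalence relation generated by welded isotopy, self-crossing virtualization (a classical crossing between two strands of one component is replaced by a virtual one) and the $2n$-move (two parallel strands, with arbitrary orientations, are replaced by the same strands with $2n$ half-twists). Let $\mathbf 1_m$ be the trivial diagram and let $*$ be the stacking product. Let $\mathcal S_k(i)$ be the set of sequences $I=j_1\dots j_k$ of $k$ distinct elements of $\{1,\dots,m\}\setminus\{i\}$ with $j_r<j_k$ for all $r<k$. For $I\in\mathcal S_k(i)$ let $T_{Ii}$ be the $\mathrm w_k$-tree for $\mathbf 1_m$ with head on the $i$th component and one tail on each of the components $j_1,\dots,j_k$, whose trunk runs from the tail on $j_k$ to the head and to which the edges coming from $j_1,\dots,j_{k-1}$ are attached in this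 order, starting from the head. Surgery along $T_{Ii}$ gives the diagram $W_{Ii}$: the heads on the $i$th component read, along the orientation, the word $[j_1,[j_2,\dots,[j_{k-1},j_k]\cdots]]$ with $[a,b]=aba^{-1}b^{-1}$, where a letter $j^{\pm1}$ is an arrow of sign $\pm1$ with its tail on the $j$th component, and there are no other arrows. Let $W_{Ii}^{-1}$ be the result of surgery on $\mathbf 1_m$ along $T_{Ii}$ with one twist inserted in the terminal edge (it is given by the inverse word), and set $(W_{Ii})^{x}=W_{Ii}*\cdots*W_{Ii}$ ($x$ factors) and $(W_{Ii})^{-x}=W_{Ii}^{-1}*\cdots*W_{Ii}^{-1}$ ($x$ factors) for $x\ge 0$. Then for every $I\in\mathcal S_k(i)$, the welded string link $(W_{Ii})^{\varepsilon n}$ is $(2n+\mathrm{sv})$-equivalent to $\mathbf 1_m$. -/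

import Mathlib

/-!
Virtual string link diagrams are encoded by their Gauss diagrams, the classical crossings being
the arrows. A virtual diagram is determined by its Gauss diagram up to planar isotopy and the
virtual moves V1, ..., V4, and every Gauss diagram comes from a virtual diagram.
-/

namespace Welded

open Finset

/-- An arrow of a Gauss diagram (a classical crossing): a label, which only serves to distinguish
the arrows of a diagram, and the sign of the crossing. -/
structure Arrow where
  label : ℕ
  sign : ℤˣ

/-- The two ends of an arrow: the tail is the overpass and the head is the underpass. -/
inductive ArrowEnd where
  | tail (a : Arrow)
  | head (a : Arrow)

/-- Change of label of an arrow. -/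
def Arrow.relabel (f : ℕ → ℕ) (a : Arrow) : Arrow := ⟨f a.label, a.sign⟩

/-- Change of label of an arrow end. -/
def ArrowEnd.relabel (f : ℕ → ℕ) : ArrowEnd → ArrowEnd
  | .tail a => .tail (a.relabel f)
  | .head a => .head (a.relabel f)

/-- The arrow ends on the `m` strands, each strand read along its orientation, belong to a Gauss
diagram: for some finite collection of arrows with distinct labels, each of its arrows has exactly
one tail and exactly one head on the strands, and nothing else lies on the strands. -/
def IsGauss {m : ℕ} (s : Fin m → List ArrowEnd) : Prop :=
  ∃ A : Multiset Arrow, (A.map Arrow.label).Nodup ∧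
    ∑ c, (s c : Multiset ArrowEnd) = A.map ArrowEnd.tail + A.map ArrowEnd.head

/-- Gauss diagrams on `m` ordered oriented strands, that is, `m`-component virtual string link
diagrams. -/
@[ext] structure GaussDiagram (m : ℕ) where
  strand : Fin m → List ArrowEnd
  isGauss : IsGauss strand

/-- The strands of a diagram on which `r` marked points `0, ..., r - 1` are chosen away from the
crossings; every marked point occurs exactly once. -/
structure MarkedStrands (m r : ℕ) where
  strand : Fin m → List (ArrowEnd ⊕ Fin r)
  mark_once : ∃ B : Multiset ArrowEnd,
    ∑ c, (strand c : Multiset (ArrowEnd ⊕ Fin r)) =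
      B.map Sum.inl + (univ : Finset (Fin r)).val.map Sum.inr

/-- Replace the marked point `p` by the sequence `X p` of arrow ends. -/
def MarkedStrands.fill {m r : ℕ} (M : MarkedStrands m r) (X : Fin r → List ArrowEnd) :
    Fin m → List ArrowEnd :=
  fun c => (M.strand c).flatMap (Sum.elim (fun e => [e]) X)

/-! ### Moves -/

/-- A sequence, or its reverse, according to a sign. -/
def orient (s : ℤˣ) (l : List ArrowEnd) : List ArrowEnd := if s = 1 then l else l.reverse

open ArrowEnd in
/-- The two sides of the moves R1, R2, R3 and OC, in a disk which meets the diagram in `r` oriented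
strands; the `p`-th entry lists the arrow ends on the `p`-th strand in the disk.

In R3 the strands are the top, the middle and the bottom one, `a` is the crossing of top and
middle, `b` that of top and bottom, `c` that of middle and bottom. Every triple of signs occurs;
it determines in which order the crossings are met on the two sides of the move. -/
inductive LocalMove : {r : ℕ} → (Fin r → List ArrowEnd) → (Fin r → List ArrowEnd) → Prop
  | r1_tail_head (a : Arrow) : LocalMove ![[]] ![[tail a, head a]]
  | r1_head_tail (a : Arrow) : LocalMove ![[]] ![[head a, tail a]]
  | r2_parallel (a b : Arrow) (h : b.sign = -a.sign) :
      LocalMove ![[], []] ![[tail a, tail b], [head a, head b]]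
  | r2_antiparallel (a b : Arrow) (h : b.sign = -a.sign) :
      LocalMove ![[], []] ![[tail a, tail b], [head b, head a]]
  | r3 (a b c : Arrow) :
      LocalMove
        ![orient (a.sign * b.sign) [tail a, tail b],
          orient (a.sign * c.sign) [head a, tail c],
          orient (b.sign * c.sign) [head b, head c]]
        ![orient (-(a.sign * b.sign)) [tail a, tail b],
          orient (-(a.sign * c.sign)) [head a, tail c],
          orient (-(b.sign * c.sign)) [head b, head c]]
  | oc (a b : Arrow) : LocalMove ![[tail a, tail b]] ![[tail b, tail a]]

/-- One welded Reidemeister move; changing the labels of the arrows is allowed as well. -/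
inductive WeldedMove {m : ℕ} : GaussDiagram m → GaussDiagram m → Prop
  | relabel (D D' : GaussDiagram m) (f : ℕ → ℕ) (hf : Function.Injective f)
      (h : ∀ c, D'.strand c = (D.strand c).map (ArrowEnd.relabel f)) : WeldedMove D D'
  | localMove (D D' : GaussDiagram m) {r : ℕ} (M : MarkedStrands m r)
      (X Y : Fin r → List ArrowEnd) (hXY : LocalMove X Y)
      (h : D.strand = M.fill X) (h' : D'.strand = M.fill Y) : WeldedMove D D'

/-- Self-crossing virtualization: a classical crossing of a component `c` with itself becomes
virtual, that is, an arrow with both ends on the strand `c` is deleted. -/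
def SelfVirtualization {m : ℕ} (D D' : GaussDiagram m) : Prop :=
  ∃ (M : MarkedStrands m 2) (a : Arrow) (c : Fin m),
    Sum.inr 0 ∈ M.strand c ∧ Sum.inr 1 ∈ M.strand c ∧
    D.strand = M.fill ![[.tail a], [.head a]] ∧ D'.strand = M.fill ![[], []]

/-- The crossings on one of two strands which are twisted around each other with crossings
`x 0, x 1, ..., x (N - 1)`: the strand passes over and under alternately, beginning with an
overpass if `first` is true. -/
def twistStrand {N : ℕ} (first : Bool) (x : Fin N → Arrow) : List ArrowEnd :=
  List.ofFn fun k =>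
    if (k.val % 2 == 0) == first then ArrowEnd.tail (x k) else ArrowEnd.head (x k)

/-- The `2n`-move: two parallel pieces of strand are replaced by the same pieces with `2n`
half-twists, which are crossings of one and the same sign `s`. If the strands are oriented
antiparallel then the second one meets the crossings in the reverse order. -/
def TwoNMove {m : ℕ} (n : ℕ) (D D' : GaussDiagram m) : Prop :=
  ∃ (M : MarkedStrands m 2) (x : Fin (2 * n) → Arrow) (s : ℤˣ),
    (∀ k, (x k).sign = s) ∧ D.strand = M.fill ![[], []] ∧
    (D'.strand = M.fill ![twistStrand true x, twistStrand false x] ∨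
      D'.strand = M.fill ![twistStrand true x, (twistStrand false x).reverse])

/-- Welded isotopy. Its equivalence classes are the welded string links. -/
def WeldedIsotopic {m : ℕ} : GaussDiagram m → GaussDiagram m → Prop :=
  Relation.EqvGen WeldedMove

/-- `(2n + sv)`-equivalence: the equivalence relation generated by the `2n`-move, self-crossing
virtualization and welded isotopy. -/
def TwoNSvEquivalent {m : ℕ} (n : ℕ) : GaussDiagram m → GaussDiagram m → Prop :=
  Relation.EqvGen fun D D' => TwoNMove n D D' ∨ SelfVirtualization D D' ∨ WeldedIsotopic D D'

/-! ### The trivial string link and the stacking product -/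

/-- The trivial string link diagram, without crossings. -/
def trivialLink (m : ℕ) : GaussDiagram m where
  strand _ := []
  isGauss := ⟨0, by simp, by simp⟩

theorem sum_relabel {m : ℕ} (s : Fin m → List ArrowEnd) (f : ℕ → ℕ) (A : Multiset Arrow)
    (h : ∑ c, (s c : Multiset ArrowEnd) = A.map ArrowEnd.tail + A.map ArrowEnd.head) :
    ∑ c, (((s c).map (ArrowEnd.relabel f) : List ArrowEnd) : Multiset ArrowEnd) =
      (A.map (Arrow.relabel f)).map ArrowEnd.tail +
        (A.map (Arrow.relabel f)).map ArrowEnd.head := by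
  have h2 := congrArg (Multiset.mapAddMonoidHom (ArrowEnd.relabel f)) h
  rw [map_sum] at h2
  simpa [Multiset.map_map, Function.comp_def, ArrowEnd.relabel] using h2

theorem nodup_labels_union (A B : Multiset Arrow) (hA : (A.map Arrow.label).Nodup)
    (hB : (B.map Arrow.label).Nodup) :
    ((A.map (Arrow.relabel (2 * ·)) + B.map (Arrow.relabel (2 * · + 1))).map
      Arrow.label).Nodup := by
  have e1 : (A.map (Arrow.relabel (2 * ·))).map Arrow.label
      = (A.map Arrow.label).map (2 * ·) := by
    simp [Multiset.map_map, Function.comp_def, Arrow.relabel]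
  have e2 : (B.map (Arrow.relabel (2 * · + 1))).map Arrow.label
      = (B.map Arrow.label).map (2 * · + 1) := by
    simp [Multiset.map_map, Function.comp_def, Arrow.relabel]
  rw [Multiset.map_add, e1, e2, Multiset.nodup_add]
  refine ⟨hA.map fun a b h => ?_, hB.map fun a b h => ?_, ?_⟩
  · omega
  · omega
  · rw [Multiset.disjoint_left]
    intro a h1 h2
    rw [Multiset.mem_map] at h1 h2
    obtain ⟨x, -, hx⟩ := h1
    obtain ⟨y, -, hy⟩ := h2
    omega

/-- The stacking product: every strand of `D` is followed by the same strand of `D'`. The labels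
are changed so that those of `D` and those of `D'` become different. -/
def GaussDiagram.stack {m : ℕ} (D D' : GaussDiagram m) : GaussDiagram m where
  strand c := (D.strand c).map (ArrowEnd.relabel (2 * ·)) ++
    (D'.strand c).map (ArrowEnd.relabel (2 * · + 1))
  isGauss := by
    obtain ⟨A, hA, h⟩ := D.isGauss
    obtain ⟨B, hB, h'⟩ := D'.isGauss
    refine ⟨A.map (Arrow.relabel (2 * ·)) + B.map (Arrow.relabel (2 * · + 1)),
      nodup_labels_union A B hA hB, ?_⟩
    simp only [← Multiset.coe_add, Finset.sum_add_distrib]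
    rw [sum_relabel _ _ A h, sum_relabel _ _ B h']
    simp only [Multiset.map_add]
    abel

/-- The stacking product of `k` copies of `D`. -/
def GaussDiagram.npow {m : ℕ} (D : GaussDiagram m) : ℕ → GaussDiagram m
  | 0 => trivialLink m
  | k + 1 => (D.npow k).stack D

/-! ### w-trees and surgery -/

/-- The shape of a w-tree whose tails lie at points of `P`: a subtree is a single edge coming from
a tail, or two subtrees joined at a trivalent vertex from which a new edge goes out, or a subtree
with a twist added to its last edge. (For a w-tree on a Gauss diagram the drawing in the plane
matters only through the order of the two ingoing edges at each trivalent vertex, and through the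
side from which the terminal edge reaches the head. The side is fixed to be the one for which a
w-arrow without twists yields a positive crossing; coming from the other side is the same as having
one more twist on the terminal edge.) -/
inductive TreeShape (P : Type) where
  | tail (p : P)
  | node (l r : TreeShape P)
  | twist (t : TreeShape P)

namespace TreeShape

/-- The points at which the tails lie. -/
def tails {P : Type} : TreeShape P → List P
  | tail p => [p]
  | node l r => l.tails ++ r.tails
  | twist t => t.tails

/-- The inverse of a word in signed letters. -/
def invWord {P : Type} (w : List (P × ℤˣ)) : List (P × ℤˣ) :=
  (w.map fun x => (x.1, -x.2)).reverse

/-- The expansion of a w-tree into w-arrows, obtained by applying the expansion move (E) as long as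
possible. The w-arrows are listed in the order of their heads along the strand; for each of them
the point near its tail and its sign are given. The expansion move replaces a tree whose terminal
edge comes from a vertex joining `l` and `r` by the four trees `l`, `r`, `l` with a twist on the
terminal edge, `r` with a twist on the terminal edge; a twist on the terminal edge inverts. -/
def expand {P : Type} : TreeShape P → List (P × ℤˣ)
  | tail p => [(p, 1)]
  | node l r => l.expand ++ r.expand ++ invWord l.expand ++ invWord r.expand
  | twist t => invWord t.expand

end TreeShape

/-- A w-tree for the diagram `D`: some marked points on the strands of `D`, a tree with its tails
and its head at marked points, and these endpoints are pairwise distinct. -/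
structure WTree {m : ℕ} (D : GaussDiagram m) where
  r : ℕ
  marked : MarkedStrands m r
  marked_fill : marked.fill (fun _ => []) = D.strand
  head : Fin r
  shape : TreeShape (Fin r)
  endpoints_nodup : (head :: shape.tails).Nodup

namespace WTree

variable {m : ℕ} {D : GaussDiagram m}

/-- The w-tree with one more twist on the terminal edge. -/
def addTwist (T : WTree D) : WTree D where
  r := T.r
  marked := T.marked
  marked_fill := T.marked_fill
  head := T.head
  shape := .twist T.shape
  endpoints_nodup := T.endpoints_nodup

/-- The w-arrows in the expansion of a w-tree, each with the marked point of its tail. -/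
def arrows (T : WTree D) : List (Fin T.r × Arrow) :=
  T.shape.expand.zipIdx.map fun x => (x.1.1, ⟨x.2, x.1.2⟩)

/-- The arrow ends which surgery along `T` puts at the marked point `p`: all the heads at the head
of `T`, and the tails of the parallel copies at each tail of `T`. -/
def endsAt (T : WTree D) (p : Fin T.r) : List ArrowEnd :=
  (if p = T.head then T.arrows.map fun x => ArrowEnd.head x.2 else []) ++
    (T.arrows.filter fun x => x.1 = p).map fun x => ArrowEnd.tail x.2

theorem sum_filter_tails {r : ℕ} (l : List (Fin r × Arrow)) :
    ∑ p, (((l.filter fun x => x.1 = p).map fun x => ArrowEnd.tail x.2 : List ArrowEnd) :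
      Multiset ArrowEnd) = ((l.map fun x => x.2 : List Arrow) : Multiset Arrow).map .tail := by
  induction l with
  | nil => simp
  | cons x l ih =>
    have : ∀ p : Fin r, ((((x :: l).filter fun x => x.1 = p).map fun x => ArrowEnd.tail x.2 :
        List ArrowEnd) : Multiset ArrowEnd) = (if x.1 = p then {ArrowEnd.tail x.2} else 0) +
        (((l.filter fun x => x.1 = p).map fun x => ArrowEnd.tail x.2 : List ArrowEnd) :
        Multiset ArrowEnd) := by
      intro p
      by_cases h : x.1 = p <;> simp [h]
    rw [Finset.sum_congr rfl fun p _ => this p, Finset.sum_add_distrib, ih]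
    simp

theorem sum_endsAt (T : WTree D) :
    ∑ p, (T.endsAt p : Multiset ArrowEnd) =
      ((T.arrows.map fun x => x.2 : List Arrow) : Multiset Arrow).map .tail +
        ((T.arrows.map fun x => x.2 : List Arrow) : Multiset Arrow).map .head := by
  have : ∀ p : Fin T.r, (T.endsAt p : Multiset ArrowEnd) =
      (if p = T.head then
        ((T.arrows.map fun x => x.2 : List Arrow) : Multiset Arrow).map .head else 0) +
      (((T.arrows.filter fun x => x.1 = p).map fun x => ArrowEnd.tail x.2 : List ArrowEnd) :
        Multiset ArrowEnd) := by
    intro p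
    by_cases h : p = T.head <;> simp [endsAt, h, Function.comp_def]
  rw [Finset.sum_congr rfl fun p _ => this p, Finset.sum_add_distrib, sum_filter_tails]
  simp [add_comm]

theorem nodup_labels (T : WTree D) :
    (((T.arrows.map fun x => x.2 : List Arrow) : Multiset Arrow).map Arrow.label).Nodup := by
  have : (T.arrows.map fun x => x.2).map Arrow.label = List.range T.shape.expand.length := by
    simp only [arrows, List.map_map, Function.comp_def]
    rw [List.range_eq_range', ← List.zipIdx_map_snd 0 T.shape.expand]
  rw [Multiset.map_coe, this]
  exact Multiset.coe_nodup.2 List.nodup_range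

end WTree

theorem MarkedStrands.sum_flatMap {m r : ℕ} (M : MarkedStrands m r) (B : Multiset ArrowEnd)
    (hB : ∑ c, (M.strand c : Multiset (ArrowEnd ⊕ Fin r)) =
      B.map Sum.inl + (univ : Finset (Fin r)).val.map Sum.inr)
    (g : ArrowEnd → List ArrowEnd) (X : Fin r → List ArrowEnd) :
    ∑ c, (((M.strand c).flatMap (Sum.elim g X) : List ArrowEnd) : Multiset ArrowEnd) =
      B.bind (fun e => (g e : Multiset ArrowEnd)) + ∑ p, (X p : Multiset ArrowEnd) := by
  have h1 : ∀ c, (((M.strand c).flatMap (Sum.elim g X) : List ArrowEnd) : Multiset ArrowEnd) =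
      (M.strand c : Multiset (ArrowEnd ⊕ Fin r)).bind
        fun y => ((Sum.elim g X y : List ArrowEnd) : Multiset ArrowEnd) :=
    fun c => (Multiset.coe_bind (M.strand c) (Sum.elim g X)).symm
  have h2 : ∀ s : Finset (Fin m), ∑ c ∈ s, (M.strand c : Multiset (ArrowEnd ⊕ Fin r)).bind
        (fun y => ((Sum.elim g X y : List ArrowEnd) : Multiset ArrowEnd)) =
      (∑ c ∈ s, (M.strand c : Multiset (ArrowEnd ⊕ Fin r))).bind
        fun y => ((Sum.elim g X y : List ArrowEnd) : Multiset ArrowEnd) := by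
    intro s
    induction s using Finset.induction_on with
    | empty => simp
    | insert c s hc ih => rw [Finset.sum_insert hc, Finset.sum_insert hc, Multiset.add_bind, ih]
  rw [Finset.sum_congr rfl fun c _ => h1 c, h2, hB, Multiset.add_bind, Multiset.bind_map,
    Multiset.bind_map]
  rfl

/-- Surgery on `D` along the w-tree `T`, that is, along the w-arrows of its expansion. The labels
are changed so that those of `D` and those of the new arrows become different. -/
def WTree.surgery {m : ℕ} {D : GaussDiagram m} (T : WTree D) : GaussDiagram m where
  strand c := (T.marked.strand c).flatMap
    (Sum.elim (fun e => [e.relabel (2 * ·)])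
      (fun p => (T.endsAt p).map (ArrowEnd.relabel (2 * · + 1))))
  isGauss := by
    obtain ⟨B, hB⟩ := T.marked.mark_once
    obtain ⟨A, hA, h⟩ := D.isGauss
    have hBA : B = A.map ArrowEnd.tail + A.map ArrowEnd.head := by
      rw [← h, ← T.marked_fill]
      have := T.marked.sum_flatMap B hB (fun e => [e]) (fun _ => [])
      have hb : B.bind (fun e => (([e] : List ArrowEnd) : Multiset ArrowEnd)) = B :=
        (Multiset.bind_singleton B id).trans (Multiset.map_id B)
      rw [hb] at this
      simp only [Multiset.coe_nil, Finset.sum_const_zero, add_zero] at this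
      exact this.symm
    refine ⟨A.map (Arrow.relabel (2 * ·)) +
      ((T.arrows.map fun x => x.2 : List Arrow) : Multiset Arrow).map
        (Arrow.relabel (2 * · + 1)), nodup_labels_union A _ hA T.nodup_labels, ?_⟩
    rw [T.marked.sum_flatMap B hB, sum_relabel T.endsAt _ _ T.sum_endsAt, hBA]
    simp only [Multiset.coe_singleton, Multiset.bind_singleton, Multiset.map_add,
      Multiset.map_map, Function.comp_def, ArrowEnd.relabel]
    abel

/-! ### The string links `W_{Ii}` -/

/-- The set `S_k(i)` of sequences `j_1 ... j_k` of `k` distinct indices, all different from `i`,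
such that the last one is larger than all the others. -/
def S {m : ℕ} (k : ℕ) (i : Fin m) : Set (List (Fin m)) :=
  {I | I.length = k ∧ I.Nodup ∧ i ∉ I ∧ ∀ j ∈ I.dropLast, ∀ l ∈ I.getLast?, j < l}

/-- The shape of `T_{Ii}` for `I = j_1 ... j_k`: along the trunk from the head to the tail `j_k`,
the branches coming from the tails `j_1, ..., j_{k-1}` are attached in this order. -/
def comb {P : Type} : (I : List P) → I ≠ [] → TreeShape P
  | [], h => absurd rfl h
  | [j], _ => .tail j
  | j :: j' :: I, _ => .node (.tail j) (comb (j' :: I) (List.cons_ne_nil _ _))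

theorem tails_comb {P : Type} : (I : List P) → (h : I ≠ []) → (comb I h).tails = I
  | [], h => absurd rfl h
  | [j], _ => rfl
  | j :: j' :: I, _ => by simp [comb, TreeShape.tails, tails_comb (j' :: I)]

theorem ne_nil_of_mem_S {m k : ℕ} {i : Fin m} {I : List (Fin m)} (hk : 1 ≤ k)
    (hI : I ∈ S k i) : I ≠ [] := by
  rintro rfl
  have := hI.1
  simp at this
  omega

/-- The strands of the trivial string link diagram with the marked point `c` on the `c`-th one. -/
def markedTrivial (m : ℕ) : MarkedStrands m m where
  strand c := [Sum.inr c]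
  mark_once := ⟨0, by
    simp only [Multiset.coe_singleton, Multiset.map_zero, zero_add]
    refine Eq.trans ?_ (Multiset.sum_map_singleton (Multiset.map Sum.inr univ.val))
    rw [Multiset.map_map]
    rfl⟩

/-- The w-tree `T_{Ii}` for the trivial string link diagram: its head lies on the `i`-th strand,
its tails lie on the strands `j_1, ..., j_k`. -/
def treeT {m k : ℕ} {i : Fin m} {I : List (Fin m)} (hk : 1 ≤ k) (hI : I ∈ S k i) :
    WTree (trivialLink m) where
  r := m
  marked := markedTrivial m
  marked_fill := by
    funext c
    simp [MarkedStrands.fill, markedTrivial, trivialLink]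
  head := i
  shape := comb I (ne_nil_of_mem_S hk hI)
  endpoints_nodup := by
    rw [tails_comb]
    exact List.nodup_cons.2 ⟨hI.2.2.1, hI.2.1⟩

/-- The string link `W_{Ii}`. -/
def W {m k : ℕ} {i : Fin m} {I : List (Fin m)} (hk : 1 ≤ k) (hI : I ∈ S k i) :
    GaussDiagram m :=
  (treeT hk hI).surgery

/-- The string link `W_{Ii}^{-1}`, with a twist inserted in the terminal edge of `T_{Ii}`. -/
def WInv {m k : ℕ} {i : Fin m} {I : List (Fin m)} (hk : 1 ≤ k) (hI : I ∈ S k i) :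
    GaussDiagram m :=
  (treeT hk hI).addTwist.surgery

/-- The powers `(W_{Ii})^x` for integers `x`, with respect to the stacking product. -/
def WPow {m k : ℕ} {i : Fin m} {I : List (Fin m)} (hk : 1 ≤ k) (hI : I ∈ S k i) :
    ℤ → GaussDiagram m
  | .ofNat x => (W hk hI).npow x
  | .negSucc x => (WInv hk hI).npow (x + 1)

end Welded

namespace Welded

open Finset

/-! ### Relabelling -/

/-! String links up to the equivalence form a monoid under stacking. In it the class `kappa n i j`
of one positive arrow from the strand `j` to the strand `i` is invertible, by R2. Surgery on the
tree of `I` gives a diagram whose class is the image of an iterated commutator under the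
homomorphism `word n i` sending the letter `j` to `kappa n i j`. The theorem thus says that the
`n`-th power of this image is trivial, `word_iteratedCommutator_pow`.

Write κ(i,j) for `kappa n i j`. The moves yield the following relations for distinct strands. By OC,
κ(i,j) and κ(l,j) commute. By R3, κ(l,j)κ(i,j) commutes with κ(i,l); with OC this extends from
letters to words, so that for a word w avoiding i and l the product of w on the strand l and w on
the strand i commutes with κ(i,l) (`commute_word_mul_word`). By the 2n-move, (κ(l,j)κ(j,l))^n = 1.
Finally κ(i,j) commutes with its conjugates by words avoiding i and j (`commute_kappa_conj`). For
this, apply the word relation to an additional strand in the role of l and glue this strand to the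
end of j: the arrow from j to it becomes a self-crossing and is virtualized.

The power is computed by induction on the length of `I`. For [l, C], the word C avoids i and l, and
C^n is trivial on the strand l by induction. The n-th power of the word relation therefore says that
C^n on the strand i commutes with κ(i,l). Since C commutes with its conjugate by κ(i,l), [κ(i,l),
C]^n = [κ(i,l), C^n] = 1.

The base case [l, j] cannot start from C = j, whose n-th power need not vanish. Instead, with x =
κ(i,l), y = κ(i,j), a = κ(l,j), b = κ(j,l), the product ab·xy commutes with x and y. As (ab)^n = 1,
its n-th power is (xy)^n, which hence commutes with x; moreover [x, xy] = [x, y], so the same power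
formula applies. -/

@[simp] theorem Arrow.relabel_id : Arrow.relabel id = id := rfl

@[simp] theorem ArrowEnd.relabel_id : ArrowEnd.relabel id = id := by
  funext e
  cases e <;> rfl

theorem ArrowEnd.relabel_relabel (f g : ℕ → ℕ) (e : ArrowEnd) :
    (e.relabel f).relabel g = e.relabel (g ∘ f) := by
  cases e <;> rfl

theorem orient_map (s : ℤˣ) (l : List ArrowEnd) (g : ArrowEnd → ArrowEnd) :
    (orient s l).map g = orient s (l.map g) := by
  unfold orient
  split_ifs <;> simp

theorem LocalMove.relabel {r : ℕ} {X Y : Fin r → List ArrowEnd} (h : LocalMove X Y)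
    (f : ℕ → ℕ) :
    LocalMove (fun p => (X p).map (ArrowEnd.relabel f))
      (fun p => (Y p).map (ArrowEnd.relabel f)) := by
  cases h with
  | r1_tail_head a =>
    convert LocalMove.r1_tail_head (a.relabel f) using 1 <;> funext p <;> fin_cases p <;> rfl
  | r1_head_tail a =>
    convert LocalMove.r1_head_tail (a.relabel f) using 1 <;> funext p <;> fin_cases p <;> rfl
  | r2_parallel a b h =>
    convert LocalMove.r2_parallel (a.relabel f) (b.relabel f) h using 1 <;> funext p <;>
      fin_cases p <;> rfl
  | r2_antiparallel a b h =>
    convert LocalMove.r2_antiparallel (a.relabel f) (b.relabel f) h using 1 <;> funext p <;>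
      fin_cases p <;> rfl
  | r3 a b c =>
    convert LocalMove.r3 (a.relabel f) (b.relabel f) (c.relabel f) using 1 <;> funext p <;>
      fin_cases p <;> simp [orient_map, ArrowEnd.relabel, Arrow.relabel]
  | oc a b =>
    convert LocalMove.oc (a.relabel f) (b.relabel f) using 1 <;> funext p <;> fin_cases p <;> rfl

theorem twistStrand_relabel {N : ℕ} (first : Bool) (x : Fin N → Arrow) (f : ℕ → ℕ) :
    (twistStrand first x).map (ArrowEnd.relabel f) =
      twistStrand first fun k => (x k).relabel f := by
  unfold twistStrand
  rw [List.map_ofFn]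
  congr 1
  funext k
  simp only [Function.comp_apply]
  split_ifs <;> rfl

/-! ### Plugging diagrams into templates -/

theorem sum_flatMap_sumElim {α β : Type*} {m r : ℕ} (s : Fin m → List (α ⊕ Fin r))
    (B : Multiset α)
    (hB : ∑ c, (s c : Multiset (α ⊕ Fin r)) =
      B.map Sum.inl + (univ : Finset (Fin r)).val.map Sum.inr)
    (g : α → List β) (X : Fin r → List β) :
    ∑ c, (((s c).flatMap (Sum.elim g X) : List β) : Multiset β) =
      B.bind (fun e => (g e : Multiset β)) + ∑ p, (X p : Multiset β) := by
  have h1 : ∀ c, (((s c).flatMap (Sum.elim g X) : List β) : Multiset β) =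
      (s c : Multiset (α ⊕ Fin r)).bind
        fun y => ((Sum.elim g X y : List β) : Multiset β) :=
    fun c => (Multiset.coe_bind (s c) (Sum.elim g X)).symm
  have h2 : ∀ t : Finset (Fin m), ∑ c ∈ t, (s c : Multiset (α ⊕ Fin r)).bind
        (fun y => ((Sum.elim g X y : List β) : Multiset β)) =
      (∑ c ∈ t, (s c : Multiset (α ⊕ Fin r))).bind
        fun y => ((Sum.elim g X y : List β) : Multiset β) := by
    intro t
    induction t using Finset.induction_on with
    | empty => simp
    | insert c t hc ih => rw [Finset.sum_insert hc, Finset.sum_insert hc, Multiset.add_bind, ih]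
  rw [Finset.sum_congr rfl fun c _ => h1 c, h2, hB, Multiset.add_bind, Multiset.bind_map,
    Multiset.bind_map]
  rfl

/-- The `c`-th marked point of a template `T` is replaced by the `c`-th marked strand of `M`, whose
arrows are relabelled by `f`. -/
def MarkedStrands.plug {m m' r : ℕ} (T : MarkedStrands m' m) (f : ℕ → ℕ)
    (M : MarkedStrands m r) : MarkedStrands m' r where
  strand c := (T.strand c).flatMap (Sum.elim (fun e => [Sum.inl e])
    fun d => (M.strand d).map (Sum.map (ArrowEnd.relabel f) id))
  mark_once := by
    obtain ⟨A, hA⟩ := T.mark_once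
    obtain ⟨B, hB⟩ := M.mark_once
    refine ⟨A + B.map (ArrowEnd.relabel f), ?_⟩
    rw [sum_flatMap_sumElim _ A hA]
    have h := congrArg (Multiset.mapAddMonoidHom
      (Sum.map (ArrowEnd.relabel f) (id : Fin r → Fin r))) hB
    rw [map_sum] at h
    simp only [Multiset.coe_mapAddMonoidHom, Multiset.map_coe, Multiset.map_add,
      Multiset.map_map] at h
    rw [h]
    simp [Multiset.map_map, Function.comp_def, Multiset.bind_singleton, add_assoc]

/-- Marking points in a diagram and inserting the diagram into a template are compatible, so a move
inside the inserted diagram is a move of the whole. -/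
theorem MarkedStrands.plug_fill {m m' r : ℕ} (T : MarkedStrands m' m) (f : ℕ → ℕ)
    (M : MarkedStrands m r) (X : Fin r → List ArrowEnd) :
    (T.plug f M).fill (fun p => (X p).map (ArrowEnd.relabel f)) =
      T.fill fun c => (M.fill X c).map (ArrowEnd.relabel f) := by
  funext c
  simp only [MarkedStrands.fill, MarkedStrands.plug, List.flatMap_assoc]
  congr 1
  funext y
  cases y with
  | inl e => simp
  | inr d =>
    simp only [Sum.elim_inr, List.flatMap_map, List.map_flatMap]
    congr 1
    funext z
    cases z <;> simp

theorem MarkedStrands.exists_mem {m r : ℕ} (M : MarkedStrands m r) (p : Fin r) :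
    ∃ c, Sum.inr p ∈ M.strand c := by
  obtain ⟨B, hB⟩ := M.mark_once
  have h : Sum.inr p ∈ ∑ c, (M.strand c : Multiset (ArrowEnd ⊕ Fin r)) := by
    rw [hB]
    simp
  rw [Multiset.mem_sum] at h
  simpa using h

theorem MarkedStrands.mem_plug {m m' r : ℕ} (T : MarkedStrands m' m) (f : ℕ → ℕ)
    (M : MarkedStrands m r) {c : Fin m'} {d : Fin m} {p : Fin r}
    (hd : Sum.inr d ∈ T.strand c) (hp : Sum.inr p ∈ M.strand d) :
    Sum.inr p ∈ (T.plug f M).strand c := by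
  simp only [MarkedStrands.plug, List.mem_flatMap]
  exact ⟨_, hd, by simpa using hp⟩

theorem TwoNSvEquivalent.of_welded {m n : ℕ} {D D' : GaussDiagram m} (h : WeldedMove D D') :
    TwoNSvEquivalent n D D' :=
  .rel _ _ (.inr (.inr (.rel _ _ h)))

theorem TwoNSvEquivalent.of_localMove {m n r : ℕ} {D D' : GaussDiagram m}
    (M : MarkedStrands m r) {X Y : Fin r → List ArrowEnd} (hXY : LocalMove X Y)
    (h : D.strand = M.fill X) (h' : D'.strand = M.fill Y) : TwoNSvEquivalent n D D' :=
  .of_welded (.localMove _ _ M X Y hXY h h')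

theorem TwoNSvEquivalent.of_relabel {m n : ℕ} {D D' : GaussDiagram m}
    (f : ℕ → ℕ) (hf : Function.Injective f)
    (h : ∀ c, D'.strand c = (D.strand c).map (ArrowEnd.relabel f)) : TwoNSvEquivalent n D D' :=
  .of_welded (.relabel _ _ f hf h)

theorem TwoNSvEquivalent.of_strand_eq {m n : ℕ} {D D' : GaussDiagram m}
    (h : D.strand = D'.strand) : TwoNSvEquivalent n D D' := by
  have : D = D' := GaussDiagram.ext h
  rw [this]
  exact .refl _

/-- Plugging diagrams into a template respects the equivalence. -/
theorem TwoNSvEquivalent.plug {m m' n : ℕ} (F : GaussDiagram m → GaussDiagram m')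
    (T : MarkedStrands m' m) (f : ℕ → ℕ)
    (hF : ∀ D, (F D).strand = T.fill fun c => (D.strand c).map (ArrowEnd.relabel f))
    (hf : ∀ g : ℕ → ℕ, Function.Injective g → ∃ h : ℕ → ℕ, Function.Injective h ∧
      h ∘ f = f ∘ g ∧ ∀ c e, Sum.inl e ∈ T.strand c → e.relabel h = e)
    {D D' : GaussDiagram m} (hD : TwoNSvEquivalent n D D') :
    TwoNSvEquivalent n (F D) (F D') := by
  have hfill : ∀ {r : ℕ} (D : GaussDiagram m) (M : MarkedStrands m r) (X), D.strand = M.fill X →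
      (F D).strand = (T.plug f M).fill (fun p => (X p).map (ArrowEnd.relabel f)) := by
    intro r D M X h
    rw [hF, h, T.plug_fill]
  have hw : ∀ D D', WeldedMove D D' → TwoNSvEquivalent n (F D) (F D') := by
    intro D D' h
    cases h with
    | relabel g hg h =>
      -- The only use of `hf`: a relabelling of the inserted diagram must extend to the whole
      -- diagram without touching the arrows of the template.
      obtain ⟨g', hg', hc, hT⟩ := hf g hg
      refine .of_relabel g' hg' fun c => ?_
      simp only [hF, MarkedStrands.fill, List.map_flatMap]
      rw [List.flatMap_def, List.flatMap_def]
      congr 1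
      refine List.map_congr_left fun y hy => ?_
      cases y with
      | inl e => simpa using (hT c e hy).symm
      | inr d =>
        simp only [Sum.elim_inr, h, List.map_map]
        refine List.map_congr_left fun e _ => ?_
        simp [ArrowEnd.relabel_relabel, hc]
    | localMove M X Y hXY h h' =>
      exact .of_localMove _ (hXY.relabel f) (hfill _ _ _ h) (hfill _ _ _ h')
  induction hD with
  | refl D => exact .refl _
  | symm _ _ _ ih => exact .symm _ _ ih
  | trans _ _ _ _ _ ih1 ih2 => exact .trans _ _ _ ih1 ih2
  | rel D D' h =>
    rcases h with ⟨M, x, s, hx, h, h'⟩ | ⟨M, a, c, h0, h1, h, h'⟩ | h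
    · refine .rel _ _ (.inl ⟨T.plug f M, fun k => (x k).relabel f, s, hx, ?_, ?_⟩)
      · rw [hfill _ _ _ h]
        congr 1
        funext p
        fin_cases p <;> rfl
      · refine h'.imp (fun h' => ?_) fun h' => ?_
        · rw [hfill _ _ _ h']
          congr 1
          funext p
          fin_cases p <;> simp [twistStrand_relabel]
        · rw [hfill _ _ _ h']
          congr 1
          funext p
          fin_cases p <;> simp [twistStrand_relabel]
    · obtain ⟨c', hc'⟩ := T.exists_mem c
      refine .rel _ _ (.inr (.inl ⟨T.plug f M, a.relabel f, c', T.mem_plug f M hc' h0,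
        T.mem_plug f M hc' h1, ?_, ?_⟩))
      · rw [hfill _ _ _ h]
        congr 1
        funext p
        fin_cases p <;> rfl
      · rw [hfill _ _ _ h']
        congr 1
        funext p
        fin_cases p <;> rfl
    · induction h with
      | rel _ _ h => exact hw _ _ h
      | refl D => exact .refl _
      | symm _ _ _ ih => exact .symm _ _ ih
      | trans _ _ _ _ _ ih1 ih2 => exact .trans _ _ _ ih1 ih2

@[simp] theorem ArrowEnd.relabel_tail (f : ℕ → ℕ) (x : ℕ) (s : ℤˣ) :
    (ArrowEnd.tail ⟨x, s⟩).relabel f = .tail ⟨f x, s⟩ := rfl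

@[simp] theorem ArrowEnd.relabel_head (f : ℕ → ℕ) (x : ℕ) (s : ℤˣ) :
    (ArrowEnd.head ⟨x, s⟩).relabel f = .head ⟨f x, s⟩ := rfl

/-! ### Templates and marked strands -/

/-- The sequence `l` on the strand `c`, and nothing on the other strands. -/
def onStrand {α : Type*} {m : ℕ} (c : Fin m) (l : List α) : Fin m → List α :=
  fun c' => if c' = c then l else []

@[simp] theorem onStrand_self {α : Type*} {m : ℕ} (c : Fin m) (l : List α) :
    onStrand c l c = l := if_pos rfl

theorem onStrand_of_ne {α : Type*} {m : ℕ} {c c' : Fin m} (h : c' ≠ c) (l : List α) :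
    onStrand c l c' = [] := if_neg h

@[simp] theorem map_onStrand {α β : Type*} {m : ℕ} (c c' : Fin m) (l : List α) (f : α → β) :
    (onStrand c l c').map f = onStrand c (l.map f) c' := by
  unfold onStrand
  split_ifs <;> rfl

@[simp] theorem flatMap_onStrand {α β : Type*} {m : ℕ} (c c' : Fin m) (l : List α)
    (f : α → List β) : (onStrand c l c').flatMap f = onStrand c (l.flatMap f) c' := by
  unfold onStrand
  split_ifs <;> rfl

@[simp] theorem sum_onStrand {α : Type*} {m : ℕ} (c : Fin m) (l : List α) :
    ∑ c', (onStrand c l c' : Multiset α) = l := by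
  rw [Finset.sum_eq_single c]
  · simp
  · intro b _ hb
    simp [onStrand_of_ne hb]
  · simp

theorem sum_map_list {α β : Type*} {m : ℕ} (s : Fin m → List α) (f : α → β) :
    ∑ c, (((s c).map f : List β) : Multiset β) = (∑ c, (s c : Multiset α)).map f := by
  rw [← Multiset.coe_mapAddMonoidHom, map_sum]
  rfl

@[simp] theorem flatMap_map_inl {α γ : Type*} (l : List α) (g : γ → List α) :
    (l.map Sum.inl).flatMap (Sum.elim (fun e => [e]) g) = l := by
  simp [List.flatMap_map]

theorem sum_singleton_inr (m : ℕ) :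
    ∑ c : Fin m, (([Sum.inr c] : List (ArrowEnd ⊕ Fin m)) : Multiset (ArrowEnd ⊕ Fin m)) =
      (univ : Finset (Fin m)).val.map Sum.inr := by
  refine Eq.trans ?_ (Multiset.sum_map_singleton (Multiset.map Sum.inr univ.val))
  rw [Multiset.map_map]
  rfl

/-- The template which puts the ends `p c` before, and the ends `q c` behind the `c`-th strand. -/
def MarkedStrands.around {m : ℕ} (p q : Fin m → List ArrowEnd) : MarkedStrands m m where
  strand c := (p c).map Sum.inl ++ [Sum.inr c] ++ (q c).map Sum.inl
  mark_once := by
    refine ⟨∑ c, (p c : Multiset ArrowEnd) + ∑ c, (q c : Multiset ArrowEnd), ?_⟩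
    simp only [← Multiset.coe_add, Finset.sum_add_distrib, sum_map_list]
    rw [sum_singleton_inr, Multiset.map_add]
    abel

theorem MarkedStrands.around_fill {m : ℕ} (p q : Fin m → List ArrowEnd)
    (X : Fin m → List ArrowEnd) :
    (MarkedStrands.around p q).fill X = fun c => p c ++ X c ++ q c := by
  funext c
  simp [MarkedStrands.around, MarkedStrands.fill]

/-- Marked points on the strands `c` and `d`, between the ends `p` and `q`. -/
def MarkedStrands.two {m : ℕ} (c d : Fin m) (p q : Fin m → List ArrowEnd) :
    MarkedStrands m 2 where
  strand e := (p e).map Sum.inl ++ onStrand c [Sum.inr 0] e ++ onStrand d [Sum.inr 1] e ++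
    (q e).map Sum.inl
  mark_once := by
    refine ⟨∑ c, (p c : Multiset ArrowEnd) + ∑ c, (q c : Multiset ArrowEnd), ?_⟩
    simp only [← Multiset.coe_add, Finset.sum_add_distrib, sum_map_list, sum_onStrand]
    rw [Multiset.map_add, show (univ : Finset (Fin 2)).val.map (Sum.inr : _ → ArrowEnd ⊕ Fin 2) =
      {Sum.inr 0} + {Sum.inr 1} from rfl]
    simp only [Multiset.coe_singleton]
    abel

theorem MarkedStrands.two_fill {m : ℕ} (c d : Fin m) (p q : Fin m → List ArrowEnd)
    (x y : List ArrowEnd) :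
    (MarkedStrands.two c d p q).fill ![x, y] =
      fun e => p e ++ onStrand c x e ++ onStrand d y e ++ q e := by
  funext e
  simp [MarkedStrands.two, MarkedStrands.fill]

/-- Marked points on the strands `b`, `c` and `d`. -/
def MarkedStrands.three {m : ℕ} (b c d : Fin m) : MarkedStrands m 3 where
  strand e := onStrand b [Sum.inr 0] e ++ onStrand c [Sum.inr 1] e ++ onStrand d [Sum.inr 2] e
  mark_once := by
    refine ⟨0, ?_⟩
    simp only [← Multiset.coe_add, Finset.sum_add_distrib, sum_onStrand]
    rfl

theorem MarkedStrands.three_fill {m : ℕ} (b c d : Fin m) (x y z : List ArrowEnd) :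
    (MarkedStrands.three b c d).fill ![x, y, z] =
      fun e => onStrand b x e ++ onStrand c y e ++ onStrand d z e := by
  funext e
  simp [MarkedStrands.three, MarkedStrands.fill]

/-! ### Permutation of tails -/

theorem IsGauss.perm {m : ℕ} {s s' : Fin m → List ArrowEnd} (h : IsGauss s)
    (hp : ∀ c, (s' c).Perm (s c)) : IsGauss s' := by
  obtain ⟨A, hA, hs⟩ := h
  refine ⟨A, hA, ?_⟩
  rw [← hs]
  exact Finset.sum_congr rfl fun c _ => Multiset.coe_eq_coe.2 (hp c)

theorem TwoNSvEquivalent.swap_tails {m n : ℕ} {D D' : GaussDiagram m} (j : Fin m)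
    (hc : ∀ c ≠ j, D'.strand c = D.strand c) {p q : List ArrowEnd} {a b : Arrow}
    (h : D.strand j = p ++ [.tail a, .tail b] ++ q)
    (h' : D'.strand j = p ++ [.tail b, .tail a] ++ q) : TwoNSvEquivalent n D D' := by
  let M : MarkedStrands m 1 :=
    { strand := fun c => if c = j then p.map Sum.inl ++ [Sum.inr 0] ++ q.map Sum.inl
        else (D.strand c).map Sum.inl
      mark_once := by
        refine ⟨∑ c, ((if c = j then p ++ q else D.strand c : List ArrowEnd) :
          Multiset ArrowEnd), ?_⟩
        rw [← sum_map_list, show (univ : Finset (Fin 1)).val.map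
          (Sum.inr : _ → ArrowEnd ⊕ Fin 1) =
            (([Sum.inr 0] : List (ArrowEnd ⊕ Fin 1)) : Multiset (ArrowEnd ⊕ Fin 1)) from rfl,
          ← sum_onStrand j, ← Finset.sum_add_distrib]
        refine Finset.sum_congr rfl fun c _ => ?_
        by_cases hcj : c = j
        · subst hcj
          simp only [if_true, onStrand_self, List.map_append, ← Multiset.coe_add]
          abel
        · simp [hcj, onStrand_of_ne hcj] }
  refine .of_localMove M (.oc a b) ?_ ?_
  · funext c
    by_cases hcj : c = j
    · subst hcj
      simp [MarkedStrands.fill, M, h]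
    · simp [MarkedStrands.fill, M, hcj]
  · funext c
    by_cases hcj : c = j
    · subst hcj
      simp [MarkedStrands.fill, M, h']
    · simp [MarkedStrands.fill, M, hcj, hc c hcj]

/-- OC exchanges adjacent tails, and these transpositions generate all permutations. The fixed
prefix `p` lets the induction on `List.Perm` pass under a `cons`. -/
theorem TwoNSvEquivalent.perm_suffix {m n : ℕ} (j : Fin m) {l l' : List ArrowEnd}
    (hl : l.Perm l') : ∀ (p : List ArrowEnd) {D D' : GaussDiagram m},
    (∀ c ≠ j, D'.strand c = D.strand c) → D.strand j = p ++ l → D'.strand j = p ++ l' →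
    (∀ e ∈ l, ∃ a, e = .tail a) → TwoNSvEquivalent n D D' := by
  induction hl with
  | nil =>
    intro p D D' hc h h' _
    refine .of_strand_eq (funext fun c => ?_)
    by_cases hcj : c = j
    · rw [hcj, h, h']
    · exact (hc c hcj).symm
  | cons x _ ih =>
    intro p D D' hc h h' ht
    exact ih (p ++ [x]) hc (by simpa using h) (by simpa using h')
      fun e he => ht e (List.mem_cons_of_mem _ he)
  | swap x y l =>
    intro p D D' hc h h' ht
    obtain ⟨a, rfl⟩ := ht x (by simp)
    obtain ⟨b, rfl⟩ := ht y (by simp)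
    exact .swap_tails j hc (p := p) (q := l) (by simpa using h) (by simpa using h')
  | @trans l₁ l₂ l₃ h₁ h₂ ih₁ ih₂ =>
    intro p D D' hc h h' ht
    have hg : IsGauss (Function.update D.strand j (p ++ l₂)) := by
      refine D.isGauss.perm fun c => ?_
      by_cases hcj : c = j
      · subst hcj
        rw [Function.update_self, h]
        exact h₁.symm.append_left p
      · rw [Function.update_of_ne hcj]
    refine .trans _ ⟨_, hg⟩ _ (ih₁ p (fun c hcj => Function.update_of_ne hcj _ _) h
      (Function.update_self _ _ _) ht) (ih₂ p (fun c hcj => ?_) (Function.update_self _ _ _) h'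
      fun e he => ht e (h₁.mem_iff.2 he))
    rw [hc c hcj]
    exact (Function.update_of_ne hcj _ _).symm

/-- The tails on a strand without heads may be permuted. -/
theorem TwoNSvEquivalent.perm_tails {m n : ℕ} {D D' : GaussDiagram m} (j : Fin m)
    (hc : ∀ c ≠ j, D'.strand c = D.strand c) (hp : (D.strand j).Perm (D'.strand j))
    (ht : ∀ e ∈ D.strand j, ∃ a, e = .tail a) : TwoNSvEquivalent n D D' :=
  .perm_suffix j hp [] hc rfl rfl ht

/-! ### The monoid of string links -/

/-- The string links with `m` components up to `(2n + sv)`-equivalence. -/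
def stringLinkSetoid (n m : ℕ) : Setoid (GaussDiagram m) :=
  ⟨TwoNSvEquivalent n, Relation.EqvGen.is_equivalence _⟩

/-- The classes of `m`-component string links up to `(2n + sv)`-equivalence. -/
def StringLink (n m : ℕ) : Type := Quotient (stringLinkSetoid n m)

/-- The class of a diagram. -/
def StringLink.mk (n : ℕ) {m : ℕ} (D : GaussDiagram m) : StringLink n m :=
  Quotient.mk (stringLinkSetoid n m) D

theorem StringLink.mk_eq {n m : ℕ} {D D' : GaussDiagram m} :
    StringLink.mk n D = StringLink.mk n D' ↔ TwoNSvEquivalent n D D' :=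
  Quotient.eq (r := stringLinkSetoid n m)

theorem StringLink.sound {n m : ℕ} {D D' : GaussDiagram m} (h : TwoNSvEquivalent n D D') :
    StringLink.mk n D = StringLink.mk n D' := mk_eq.2 h

theorem TwoNSvEquivalent.stack_right {n m : ℕ} {D D' : GaussDiagram m} (E : GaussDiagram m)
    (h : TwoNSvEquivalent n D D') : TwoNSvEquivalent n (D.stack E) (D'.stack E) := by
  refine h.plug (fun D => D.stack E)
    (.around (fun _ => []) fun c => (E.strand c).map (ArrowEnd.relabel (2 * · + 1))) (2 * ·)
    -- In the stack the arrows of the varying diagram have even labels and those of `E` odd ones, so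
    -- `g` acts on the even labels only.
    (fun D => ?_) fun g hg => ⟨fun x => if x % 2 = 0 then 2 * g (x / 2) else x, ?_, ?_, ?_⟩
  · rw [MarkedStrands.around_fill]
    rfl
  · intro x y hxy
    dsimp only at hxy
    split_ifs at hxy
    · have := @hg (x / 2) (y / 2) (by omega)
      omega
    · omega
    · omega
    · exact hxy
  · funext x
    simp
  · intro c e he
    simp only [MarkedStrands.around, List.map_nil, List.nil_append, List.mem_append,
      List.mem_singleton, reduceCtorEq, List.mem_map, Sum.inl.injEq, exists_eq_right,
      false_or] at he
    obtain ⟨x, -, rfl⟩ := he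
    rw [ArrowEnd.relabel_relabel]
    congr 1
    funext y
    simp [Nat.add_mod]

theorem TwoNSvEquivalent.stack_left {n m : ℕ} {D D' : GaussDiagram m} (E : GaussDiagram m)
    (h : TwoNSvEquivalent n D D') : TwoNSvEquivalent n (E.stack D) (E.stack D') := by
  refine h.plug (fun D => E.stack D)
    (.around (fun c => (E.strand c).map (ArrowEnd.relabel (2 * ·))) fun _ => []) (2 * · + 1)
    (fun D => ?_)
    fun g hg => ⟨fun x => if x % 2 = 1 then 2 * g (x / 2) + 1 else x, ?_, ?_, ?_⟩
  · rw [MarkedStrands.around_fill]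
    simp only [List.append_nil]
    rfl
  · intro x y hxy
    dsimp only at hxy
    split_ifs at hxy
    · have := @hg (x / 2) (y / 2) (by omega)
      omega
    · omega
    · omega
    · exact hxy
  · funext x
    simp only [Function.comp_apply]
    rw [if_pos (by omega), show (2 * x + 1) / 2 = x by omega]
  · intro c e he
    simp only [MarkedStrands.around, List.map_nil, List.append_nil, List.mem_append,
      List.mem_singleton, reduceCtorEq, List.mem_map, Sum.inl.injEq, exists_eq_right,
      or_false] at he
    obtain ⟨x, -, rfl⟩ := he
    rw [ArrowEnd.relabel_relabel]
    congr 1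
    funext y
    simp

instance (n m : ℕ) : Monoid (StringLink n m) where
  one := .mk n (trivialLink m)
  mul := Quotient.map₂ GaussDiagram.stack fun _ D' h _ _ h' =>
    (h.stack_right _).trans _ _ _ (TwoNSvEquivalent.stack_left D' h')
  mul_assoc a b c := by
    induction a using Quotient.inductionOn
    induction b using Quotient.inductionOn
    induction c using Quotient.inductionOn
    refine StringLink.sound (.of_relabel
      -- A label `x` of the three factors becomes `4x`, `4x + 2`, `2x + 1` under one bracketing and
      -- `2x`, `4x + 1`, `4x + 3` under the other.
      (fun x => if x % 4 = 0 then x / 2 else if x % 4 = 2 then x - 1 else 2 * x + 1) ?_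
        fun c => ?_)
    · intro x y hxy
      dsimp only at hxy
      split_ifs at hxy <;> omega
    · simp only [GaussDiagram.stack, List.map_append, List.map_map, List.append_assoc]
      congr 1
      · refine List.map_congr_left fun e _ => ?_
        simp only [Function.comp_apply, ArrowEnd.relabel_relabel]
        congr 1
        funext x
        simp only [Function.comp_apply]
        rw [if_pos (by omega)]
        omega
      congr 1
      · refine List.map_congr_left fun e _ => ?_
        simp only [Function.comp_apply, ArrowEnd.relabel_relabel]
        congr 1
        funext x
        simp only [Function.comp_apply]
        rw [if_neg (by omega), if_pos (by omega)]
        omega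
      · refine List.map_congr_left fun e _ => ?_
        simp only [Function.comp_apply, ArrowEnd.relabel_relabel]
        congr 1
        funext x
        simp only [Function.comp_apply]
        rw [if_neg (by omega), if_neg (by omega)]
  one_mul a := by
    induction a using Quotient.inductionOn
    refine (StringLink.sound (.of_relabel (2 * · + 1) ?_ fun c => ?_)).symm
    · intro x y hxy
      dsimp only at hxy
      omega
    · simp [GaussDiagram.stack, trivialLink]
  mul_one a := by
    induction a using Quotient.inductionOn
    refine (StringLink.sound (.of_relabel (2 * ·) ?_ fun c => ?_)).symm
    · intro x y hxy
      dsimp only at hxy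
      omega
    · simp [GaussDiagram.stack, trivialLink]

namespace StringLink

theorem mk_stack (n : ℕ) {m : ℕ} (D E : GaussDiagram m) :
    mk n (D.stack E) = mk n D * mk n E := rfl

theorem mk_trivial (n m : ℕ) : mk n (trivialLink m) = 1 := rfl

theorem mk_npow (n : ℕ) {m : ℕ} (D : GaussDiagram m) (x : ℕ) :
    mk n (D.npow x) = mk n D ^ x := by
  induction x with
  | zero => rfl
  | succ x ih => rw [GaussDiagram.npow, mk_stack, ih, pow_succ]

/-! ### Single arrows -/

/-- The diagram with a single arrow, from the strand `j` to the strand `i`. -/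
def single {m : ℕ} (i j : Fin m) (s : ℤˣ) : GaussDiagram m where
  strand c := onStrand j [.tail ⟨0, s⟩] c ++ onStrand i [.head ⟨0, s⟩] c
  isGauss := by
    refine ⟨{⟨0, s⟩}, by simp, ?_⟩
    simp only [← Multiset.coe_add, Finset.sum_add_distrib, sum_onStrand]
    rfl

theorem single_self (n : ℕ) {m : ℕ} (i : Fin m) (s : ℤˣ) : mk n (single i i s) = 1 := by
  refine sound (.rel _ _ (.inr (.inl ⟨.two i i (fun _ => []) fun _ => [], ⟨0, s⟩, i,
    ?_, ?_, ?_, ?_⟩)))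
  · simp [MarkedStrands.two]
  · simp [MarkedStrands.two]
  · rw [MarkedStrands.two_fill]
    simp [single]
  · rw [MarkedStrands.two_fill]
    funext c
    simp [trivialLink, onStrand]

theorem single_mul_single_neg (n : ℕ) {m : ℕ} (i j : Fin m) (s : ℤˣ) :
    mk n (single i j s) * mk n (single i j (-s)) = 1 := by
  -- On a single strand the stack reads tail, head, tail, head, which is not the pattern of R2;
  -- there the arrows are virtualized instead.
  by_cases hij : i = j
  · subst hij
    rw [single_self, single_self, one_mul]
  refine (sound (.of_localMove (.two j i (fun _ => []) fun _ => [])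
    (.r2_parallel ⟨0, s⟩ ⟨1, -s⟩ rfl) ?_ ?_)).symm
  · rw [MarkedStrands.two_fill]
    funext c
    simp [trivialLink, onStrand]
  · rw [MarkedStrands.two_fill]
    funext c
    by_cases h1 : c = j
    · subst h1
      simp [GaussDiagram.stack, single, onStrand, Ne.symm hij]
    · simp [GaussDiagram.stack, single, onStrand, h1]
      split_ifs <;> simp

/-- The invertible class of the positive arrow from the strand `j` to the strand `i`. -/
def kappa (n : ℕ) {m : ℕ} (i j : Fin m) : (StringLink n m)ˣ where
  val := mk n (single i j 1)
  inv := mk n (single i j (-1))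
  val_inv := single_mul_single_neg n i j 1
  inv_val := by simpa using single_mul_single_neg n i j (-1)

theorem mk_single (n : ℕ) {m : ℕ} (i j : Fin m) (s : ℤˣ) :
    mk n (single i j s) = ((kappa n i j ^ (s : ℤ) : (StringLink n m)ˣ) : StringLink n m) := by
  rcases Int.units_eq_one_or s with rfl | rfl
  · simp [kappa]
  · simp [kappa]

/-- Exchange of `2a` and `2a + 1`. -/
def swapParity (x : ℕ) : ℕ := if x % 2 = 0 then x + 1 else x - 1

theorem swapParity_injective : Function.Injective swapParity := by
  intro x y h
  unfold swapParity at h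
  split_ifs at h <;> omega

theorem relabel_swapParity (e : ArrowEnd) :
    (e.relabel (2 * ·)).relabel swapParity = e.relabel (2 * · + 1) := by
  rw [ArrowEnd.relabel_relabel]
  congr 1
  funext x
  simp [swapParity]

theorem relabel_swapParity' (e : ArrowEnd) :
    (e.relabel (2 * · + 1)).relabel swapParity = e.relabel (2 * ·) := by
  rw [ArrowEnd.relabel_relabel]
  congr 1
  funext x
  simp only [swapParity, Function.comp_apply]
  rw [if_neg (by omega)]
  rfl

/-- Diagrams commute if they meet at most in one strand, on which they have no heads. -/
theorem commute_of_tails (n : ℕ) {m : ℕ} {D E : GaussDiagram m} (j : Fin m)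
    (h : ∀ c ≠ j, D.strand c = [] ∨ E.strand c = [])
    (hD : ∀ e ∈ D.strand j, ∃ a, e = .tail a) (hE : ∀ e ∈ E.strand j, ∃ a, e = .tail a) :
    Commute (mk n D) (mk n E) := by
  let F : GaussDiagram m :=
    { strand := fun c => (E.strand c).map (ArrowEnd.relabel (2 * · + 1)) ++
        (D.strand c).map (ArrowEnd.relabel (2 * ·))
      isGauss := (D.stack E).isGauss.perm fun c => List.perm_append_comm }
  refine Eq.trans (sound (D' := F) (.perm_tails j (fun c hc => ?_) List.perm_append_comm ?_))
    (sound (.of_relabel swapParity swapParity_injective fun c => ?_))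
  · rcases h c hc with h | h <;> simp [F, GaussDiagram.stack, h]
  · intro e he
    simp only [GaussDiagram.stack, List.mem_append, List.mem_map] at he
    rcases he with ⟨x, hx, rfl⟩ | ⟨x, hx, rfl⟩
    · obtain ⟨a, rfl⟩ := hD x hx
      exact ⟨_, rfl⟩
    · obtain ⟨a, rfl⟩ := hE x hx
      exact ⟨_, rfl⟩
  · simp only [GaussDiagram.stack, F, List.map_append, List.map_map]
    congr 1
    · exact List.map_congr_left fun e _ => (relabel_swapParity' e).symm
    · exact List.map_congr_left fun e _ => (relabel_swapParity e).symm

theorem commute_kappa_disjoint (n : ℕ) {m : ℕ} {i j k l : Fin m} (hij : i ≠ j)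
    (h1 : k ≠ i) (h2 : k ≠ j)
    (h3 : l ≠ i) (h4 : l ≠ j) : Commute (kappa n i j) (kappa n k l) := by
  refine Units.ext (commute_of_tails n (D := single i j 1) (E := single k l 1) j ?_ ?_ ?_)
  · intro c hc
    by_cases hci : c = i
    · subst hci
      right
      simp [single, onStrand, h1.symm, h3.symm]
    · left
      simp [single, onStrand, hc, hci]
  · simp [single, onStrand, hij.symm]
  · simp [single, onStrand, h2.symm, h4.symm]

theorem commute_kappa_tails (n : ℕ) {m : ℕ} {i j l : Fin m} (hij : i ≠ j) (hlj : l ≠ j)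
    (hil : i ≠ l) : Commute (kappa n i j) (kappa n l j) := by
  refine Units.ext (commute_of_tails n (D := single i j 1) (E := single l j 1) j ?_ ?_ ?_)
  · intro c hc
    by_cases hci : c = i
    · subst hci
      right
      simp [single, onStrand, hc, hil]
    · left
      simp [single, onStrand, hc, hci]
  · simp [single, onStrand, hij.symm]
  · simp [single, onStrand, hlj.symm]

/-- This is R3 with `j` as top, `l` as middle and `i` as bottom strand. -/
theorem kappa_r3 (n : ℕ) {m : ℕ} {i j l : Fin m} (hij : i ≠ j) (hlj : l ≠ j) (hil : i ≠ l) :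
    kappa n l j * kappa n i j * kappa n i l = kappa n i l * kappa n i j * kappa n l j := by
  have h : mk n (((single l j 1).stack (single i j 1)).stack (single i l 1)) =
      mk n (((single i l 1).stack (single i j 1)).stack (single l j 1)) := by
    -- The labels are those which the left stack gives to its three arrows. All signs are positive,
    -- so the two sides of R3 differ by reversing the order on each strand.
    have hloc := LocalMove.r3 ⟨0, 1⟩ ⟨2, 1⟩ ⟨1, 1⟩
    simp only [mul_one, orient, if_true,
      if_neg (show ¬ (-1 : ℤˣ) = 1 by decide), List.reverse_cons, List.reverse_nil,
      List.nil_append, List.cons_append] at hloc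
    -- Exchanging the outer factors exchanges the labels 0 and 1 and keeps the label 2 of the middle
    -- arrow.
    have hF : ∀ c, (MarkedStrands.three j l i).fill
        ![[.tail ⟨2, 1⟩, .tail ⟨0, 1⟩], [.tail ⟨1, 1⟩, .head ⟨0, 1⟩],
          [.head ⟨1, 1⟩, .head ⟨2, 1⟩]] c =
        ((((single i l 1).stack (single i j 1)).stack (single l j 1)).strand c).map
          (ArrowEnd.relabel (Equiv.swap 0 1)) := by
      intro c
      have h2 : Equiv.swap 0 1 2 = 2 := by decide
      rw [MarkedStrands.three_fill]
      rcases eq_or_ne c i with rfl | hi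
      · simp [GaussDiagram.stack, single, onStrand, hij, hil, h2]
      rcases eq_or_ne c j with rfl | hj
      · simp [GaussDiagram.stack, single, onStrand, hi, hlj.symm, h2]
      rcases eq_or_ne c l with rfl | hl
      · simp [GaussDiagram.stack, single, onStrand, hi, hj]
      · simp [GaussDiagram.stack, single, onStrand, hi, hj, hl]
    have hL : (((single l j 1).stack (single i j 1)).stack (single i l 1)).strand =
        (MarkedStrands.three j l i).fill
          ![[.tail ⟨0, 1⟩, .tail ⟨2, 1⟩], [.head ⟨0, 1⟩, .tail ⟨1, 1⟩],
            [.head ⟨2, 1⟩, .head ⟨1, 1⟩]] := by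
      funext c
      rw [MarkedStrands.three_fill]
      rcases eq_or_ne c i with rfl | hi
      · simp [GaussDiagram.stack, single, onStrand, hij, hil]
      rcases eq_or_ne c j with rfl | hj
      · simp [GaussDiagram.stack, single, onStrand, hi, hlj.symm]
      rcases eq_or_ne c l with rfl | hl
      · simp [GaussDiagram.stack, single, onStrand, hi, hj]
      · simp [GaussDiagram.stack, single, onStrand, hi, hj, hl]
    have hswap : ∀ (c d : Fin m) (x y : ArrowEnd),
        (onStrand c [x, y] d).Perm (onStrand c [y, x] d) := by
      intro c d x y
      unfold onStrand
      split_ifs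
      · exact .swap _ _ _
      · exact .refl _
    refine (sound (.of_localMove (D' := ⟨_, (((single l j 1).stack (single i j 1)).stack
      (single i l 1)).isGauss.perm fun c => ?_⟩)
      (.three j l i) hloc hL rfl)).trans
      (sound (.of_relabel _ (Equiv.swap 0 1).injective hF)).symm
    rw [hL, MarkedStrands.three_fill]
    refine (List.Perm.of_eq (congrFun (MarkedStrands.three_fill j l i _ _ _) c)).trans ?_
    exact ((hswap _ _ _ _).append (hswap _ _ _ _)).append (hswap _ _ _ _)
  exact Units.ext h

/-! ### Sequences of arrows -/

/-- The ends on the strand `c` of an arrow which is given by the strands of its head and its tail,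
its sign and its label. -/
def arrowEndsOn {m : ℕ} (c : Fin m) (x : (Fin m × Fin m × ℤˣ) × ℕ) : List ArrowEnd :=
  onStrand x.1.2.1 [.tail ⟨x.2, x.1.2.2⟩] c ++ onStrand x.1.1 [.head ⟨x.2, x.1.2.2⟩] c

theorem sum_arrowEndsOn {m : ℕ} (l : List ((Fin m × Fin m × ℤˣ) × ℕ)) :
    ∑ c, ((l.flatMap (arrowEndsOn c) : List ArrowEnd) : Multiset ArrowEnd) =
      ((l.map fun x => (⟨x.2, x.1.2.2⟩ : Arrow) : List Arrow) : Multiset Arrow).map .tail +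
        ((l.map fun x => (⟨x.2, x.1.2.2⟩ : Arrow) : List Arrow) : Multiset Arrow).map .head := by
  induction l with
  | nil => simp
  | cons x l ih =>
    simp only [List.flatMap_cons, ← Multiset.coe_add, Finset.sum_add_distrib, ih, arrowEndsOn,
      sum_onStrand, List.map_cons, ← Multiset.cons_coe, Multiset.coe_nil,
      ← Multiset.singleton_add, Multiset.map_add, Multiset.map_singleton]
    abel

/-- The diagram whose arrows, listed in the order in which their ends are met along the strands,
are given by the strands of their heads and their tails, and their signs. -/
def sequence {m : ℕ} (w : List (Fin m × Fin m × ℤˣ)) : GaussDiagram m where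
  strand c := w.zipIdx.flatMap (arrowEndsOn c)
  isGauss := by
    refine ⟨_, ?_, sum_arrowEndsOn _⟩
    rw [Multiset.map_coe, List.map_map]
    refine Multiset.coe_nodup.2 ?_
    change (w.zipIdx.map Prod.snd).Nodup
    rw [List.zipIdx_map_snd]
    exact List.nodup_range'

/-- A diagram whose arrows can be listed consistently along all strands is the stack of its arrows,
so its class is a product of generators. -/
theorem mk_sequence (n : ℕ) {m : ℕ} (w : List (Fin m × Fin m × ℤˣ)) :
    mk n (sequence w) =
      ((w.map fun x => kappa n x.1 x.2.1 ^ (x.2.2 : ℤ)).prod : (StringLink n m)ˣ) := by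
  induction w using List.reverseRecOn with
  | nil => rfl
  | append_singleton w x ih =>
    obtain ⟨i, j, s⟩ := x
    rw [List.map_append, List.prod_append, Units.val_mul, ← ih, List.map_singleton,
      List.prod_singleton, ← mk_single, ← mk_stack]
    -- The last arrow has label `w.length` in the sequence and 1 in the stack; the labels before it
    -- are doubled.
    refine sound (.of_relabel (fun a => if a = w.length then 1 else 2 * a) ?_ fun c => ?_)
    · intro a b hab
      dsimp only at hab
      split_ifs at hab <;> omega
    · simp only [GaussDiagram.stack, sequence, List.zipIdx_append, List.flatMap_append,
        List.map_append, List.map_flatMap, zero_add]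
      congr 1
      · rw [List.flatMap_def, List.flatMap_def]
        congr 1
        refine List.map_congr_left fun y hy => ?_
        have hy' : y.2 ≠ w.length := by
          have := List.snd_lt_of_mem_zipIdx hy
          omega
        simp [arrowEndsOn, hy']
      · simp [arrowEndsOn, single]

/-! ### The `2n`-move on two components -/

theorem zipIdx_map_range {α : Type*} (N : ℕ) (f : ℕ → α) :
    ((List.range N).map f).zipIdx = (List.range N).map fun k => (f k, k) := by
  refine List.ext_getElem (by simp) fun k _ _ => ?_
  simp

theorem ofFn_eq_map_range {α : Type*} (N : ℕ) (f : ℕ → α) :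
    (List.ofFn fun k : Fin N => f k) = (List.range N).map f := by
  refine List.ext_getElem (by simp) fun k _ _ => ?_
  simp

/-- In a twist region the two strands pass over each other alternately, so the `2 * n` positive
crossings of a parallel twist are `n` pairs of opposite arrows. The 2n-move creates them from the
trivial diagram. -/
theorem kappa_mul_kappa_pow (n : ℕ) {m : ℕ} {i j : Fin m} (hij : i ≠ j) :
    (kappa n j i * kappa n i j) ^ n = 1 := by
  let w : ℕ → Fin m × Fin m × ℤˣ := fun k => if k % 2 = 0 then (j, i, 1) else (i, j, 1)
  have hw : ∀ N, (((List.range (2 * N)).map w).map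
      fun x => kappa n x.1 x.2.1 ^ (x.2.2 : ℤ)).prod = (kappa n j i * kappa n i j) ^ N := by
    intro N
    induction N with
    | zero => simp
    | succ N ih =>
      rw [show 2 * (N + 1) = 2 * N + 1 + 1 by ring, List.range_succ, List.range_succ,
        List.map_append, List.map_append, List.map_append, List.map_append, List.prod_append,
        List.prod_append, ih, pow_succ]
      have h1 : w (2 * N) = (j, i, 1) := by simp [w]
      have h2 : w (2 * N + 1) = (i, j, 1) := by
        simp only [w]
        rw [if_neg (by omega)]
      simp [h1, h2, mul_assoc]
  rw [← hw]
  refine Units.ext ?_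
  rw [← mk_sequence]
  refine (sound (.rel _ _ (.inl ⟨.two i j (fun _ => []) fun _ => [], fun k => ⟨k, 1⟩, 1,
    fun _ => rfl, ?_, .inl ?_⟩))).symm
  · rw [MarkedStrands.two_fill]
    funext c
    simp [trivialLink, onStrand]
  · rw [MarkedStrands.two_fill]
    funext c
    have ht : ∀ b : Bool, twistStrand b (fun k : Fin (2 * n) => (⟨k, 1⟩ : Arrow)) =
        (List.range (2 * n)).map fun k =>
          if (k % 2 == 0) == b then ArrowEnd.tail ⟨k, 1⟩ else ArrowEnd.head ⟨k, 1⟩ :=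
      fun b => ofFn_eq_map_range (2 * n) fun k =>
        if (k % 2 == 0) == b then ArrowEnd.tail ⟨k, 1⟩ else ArrowEnd.head ⟨k, 1⟩
    simp only [sequence, zipIdx_map_range, ht, List.flatMap_map, List.nil_append,
      List.append_nil]
    rcases eq_or_ne c i with rfl | hi
    · rw [onStrand_self, onStrand_of_ne hij, List.append_nil, List.map_eq_flatMap]
      congr 1
      funext k
      by_cases hk : k % 2 = 0 <;> simp [arrowEndsOn, w, hk, onStrand, hij]
    rcases eq_or_ne c j with rfl | hj
    · rw [onStrand_self, onStrand_of_ne hij.symm, List.nil_append, List.map_eq_flatMap]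
      congr 1
      funext k
      by_cases hk : k % 2 = 0 <;> simp [arrowEndsOn, w, hk, onStrand, hij.symm]
    · rw [onStrand_of_ne hi, onStrand_of_ne hj, List.append_nil]
      refine List.flatMap_eq_nil_iff.2 fun k _ => ?_
      by_cases hk : k % 2 = 0 <;> simp [arrowEndsOn, w, hk, onStrand, hi, hj]

/-! ### Surgery on the trivial diagram -/

theorem exists_mem_of_mem_invWord {P : Type} {w : List (P × ℤˣ)} {x : P × ℤˣ}
    (h : x ∈ TreeShape.invWord w) : ∃ y ∈ w, y.1 = x.1 := by
  simp only [TreeShape.invWord, List.mem_reverse, List.mem_map] at h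
  obtain ⟨y, hy, rfl⟩ := h
  exact ⟨y, hy, rfl⟩

theorem mem_tails_of_mem_expand {P : Type} (t : TreeShape P) :
    ∀ x ∈ t.expand, x.1 ∈ t.tails := by
  induction t with
  | tail p => simp [TreeShape.expand, TreeShape.tails]
  | node l r ihl ihr =>
    intro x hx
    simp only [TreeShape.expand, List.mem_append] at hx
    simp only [TreeShape.tails, List.mem_append]
    rcases hx with ((hx | hx) | hx) | hx
    · exact .inl (ihl x hx)
    · exact .inr (ihr x hx)
    · obtain ⟨y, hy, h⟩ := exists_mem_of_mem_invWord hx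
      exact .inl (h ▸ ihl y hy)
    · obtain ⟨y, hy, h⟩ := exists_mem_of_mem_invWord hx
      exact .inr (h ▸ ihr y hy)
  | twist t ih =>
    intro x hx
    obtain ⟨y, hy, h⟩ := exists_mem_of_mem_invWord hx
    exact h ▸ ih y hy

/-- All heads lie on the strand `i` and all tails elsewhere, each strand meeting the arrows in the
order of the expansion. The result is therefore a sequence of arrows, up to labels. -/
theorem mk_surgery (n : ℕ) {m : ℕ}
    (hfill : (markedTrivial m).fill (fun _ => []) = (trivialLink m).strand) (i : Fin m)
    (t : TreeShape (Fin m)) (ht : (i :: t.tails).Nodup) :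
    mk n (WTree.surgery ⟨m, markedTrivial m, hfill, i, t, ht⟩) =
      ((t.expand.map fun x => kappa n i x.1 ^ (x.2 : ℤ)).prod : (StringLink n m)ˣ) := by
  have hi : ∀ x ∈ t.expand, x.1 ≠ i := fun x hx h =>
    (List.nodup_cons.1 ht).1 (h ▸ mem_tails_of_mem_expand t x hx)
  have h := mk_sequence n (t.expand.map fun x => (i, x.1, x.2))
  rw [List.map_map] at h
  refine Eq.trans (Eq.symm ?_) h
  refine sound (.of_relabel (2 * · + 1) ?_ fun c => ?_)
  · intro x y hxy
    dsimp only at hxy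
    omega
  simp only [WTree.surgery, markedTrivial, List.flatMap_singleton, Sum.elim_inr, sequence]
  congr 1
  rw [List.zipIdx_map, List.flatMap_map]
  simp only [WTree.endsAt, WTree.arrows, List.map_map, List.filter_map]
  have hz : ∀ x ∈ t.expand.zipIdx, x.1.1 ≠ i := fun x hx => hi _ (List.fst_mem_of_mem_zipIdx hx)
  generalize t.expand.zipIdx = l at hz
  rcases eq_or_ne c i with rfl | hc
  · rw [if_pos rfl, List.filter_eq_nil_iff.2 (by simpa using hz), List.map_nil, List.append_nil,
      List.map_eq_flatMap, List.flatMap_def, List.flatMap_def]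
    congr 1
    refine List.map_congr_left fun x hx => ?_
    simp [arrowEndsOn, onStrand_of_ne (hz x hx).symm]
  · rw [if_neg hc, List.nil_append]
    induction l with
    | nil => rfl
    | cons x l ih =>
      rw [List.flatMap_cons, ← ih fun y hy => hz y (List.mem_cons_of_mem _ hy), List.filter_cons]
      by_cases hx : c = x.1.1
      · subst hx
        simp [arrowEndsOn, onStrand, hc]
      · simp [arrowEndsOn, onStrand, hc, hx, Ne.symm hx]

end StringLink

/-! ### Gluing two strands -/

/-- The template which glues the last strand to the end of the strand `j`. -/
def glueTemplate {m : ℕ} (j : Fin m) : MarkedStrands m (m + 1) where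
  strand c := [Sum.inr c.castSucc] ++ onStrand j [Sum.inr (Fin.last m)] c
  mark_once := by
    refine ⟨0, ?_⟩
    simp only [← Multiset.coe_add, Finset.sum_add_distrib, sum_onStrand]
    rw [← sum_singleton_inr, Fin.sum_univ_castSucc, Multiset.map_zero, zero_add]

/-- The template which adds an empty last strand. -/
def addStrandTemplate (m : ℕ) : MarkedStrands (m + 1) m where
  strand := Fin.snoc (α := fun _ => List (ArrowEnd ⊕ Fin m)) (fun c => [Sum.inr c]) []
  mark_once := by
    refine ⟨0, ?_⟩
    rw [← sum_singleton_inr, Fin.sum_univ_castSucc]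
    simp

/-- The last strand is glued to the end of the strand `j`. -/
def GaussDiagram.glue {m : ℕ} (j : Fin m) (D : GaussDiagram (m + 1)) : GaussDiagram m where
  strand c := D.strand c.castSucc ++ onStrand j (D.strand (Fin.last m)) c
  isGauss := by
    obtain ⟨A, hA, h⟩ := D.isGauss
    refine ⟨A, hA, ?_⟩
    simp only [← Multiset.coe_add, Finset.sum_add_distrib, sum_onStrand]
    rw [← h, Fin.sum_univ_castSucc]

/-- An empty last strand is added. -/
def GaussDiagram.addStrand {m : ℕ} (D : GaussDiagram m) : GaussDiagram (m + 1) where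
  strand := Fin.snoc (α := fun _ => List ArrowEnd) D.strand []
  isGauss := by
    obtain ⟨A, hA, h⟩ := D.isGauss
    refine ⟨A, hA, ?_⟩
    rw [← h, Fin.sum_univ_castSucc]
    simp

theorem glueTemplate_fill {m : ℕ} (j : Fin m) (X : Fin (m + 1) → List ArrowEnd) :
    (glueTemplate j).fill X = fun c => X c.castSucc ++ onStrand j (X (Fin.last m)) c := by
  funext c
  simp [glueTemplate, MarkedStrands.fill]

theorem TwoNSvEquivalent.glue {n m : ℕ} (j : Fin m) {D D' : GaussDiagram (m + 1)}
    (h : TwoNSvEquivalent n D D') : TwoNSvEquivalent n (D.glue j) (D'.glue j) := by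
  refine h.plug (GaussDiagram.glue j) (glueTemplate j) id (fun D => ?_)
    fun g hg => ⟨g, hg, rfl, ?_⟩
  · rw [glueTemplate_fill]
    simp [GaussDiagram.glue]
  · intro c e he
    simp [glueTemplate, onStrand] at he

theorem TwoNSvEquivalent.addStrand {n m : ℕ} {D D' : GaussDiagram m}
    (h : TwoNSvEquivalent n D D') : TwoNSvEquivalent n D.addStrand D'.addStrand := by
  refine h.plug GaussDiagram.addStrand (addStrandTemplate m) id (fun D => ?_)
    fun g hg => ⟨g, hg, rfl, ?_⟩
  · funext c
    refine Fin.lastCases ?_ (fun c => ?_) c <;>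
      simp [GaussDiagram.addStrand, addStrandTemplate, MarkedStrands.fill]
  · intro c e
    refine Fin.lastCases ?_ (fun c => ?_) c <;> simp [addStrandTemplate]

namespace StringLink

/-- The last strand is glued to the end of the strand `j`. -/
def glue {n m : ℕ} (j : Fin m) : StringLink n (m + 1) → StringLink n m :=
  Quotient.map (GaussDiagram.glue j) fun _ _ h => h.glue j

/-- An empty last strand is added. -/
def addStrand (n m : ℕ) : StringLink n m →* StringLink n (m + 1) where
  toFun := Quotient.map GaussDiagram.addStrand fun _ _ h => h.addStrand
  map_one' := by
    refine congrArg (mk n) (GaussDiagram.ext (funext fun c => ?_))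
    refine Fin.lastCases ?_ (fun c => ?_) c <;> simp [GaussDiagram.addStrand, trivialLink]
  map_mul' a b := by
    induction a using Quotient.inductionOn
    induction b using Quotient.inductionOn
    refine congrArg (mk n) (GaussDiagram.ext (funext fun c => ?_))
    refine Fin.lastCases ?_ (fun c => ?_) c <;>
      simp [GaussDiagram.addStrand, GaussDiagram.stack]

theorem onStrand_castSucc {α : Type*} {m : ℕ} (c d : Fin m) (l : List α) :
    onStrand c.castSucc l d.castSucc = onStrand c l d := by
  simp [onStrand]

theorem addStrand_single {m : ℕ} (i j : Fin m) (s : ℤˣ) :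
    (single i j s).addStrand = single i.castSucc j.castSucc s := by
  refine GaussDiagram.ext (funext fun c => ?_)
  refine Fin.lastCases ?_ (fun c => ?_) c
  · simp [GaussDiagram.addStrand, single, onStrand, (Fin.castSucc_lt_last _).ne']
  · simp [GaussDiagram.addStrand, single, onStrand_castSucc]

theorem addStrand_kappa (n : ℕ) {m : ℕ} (i j : Fin m) :
    Units.map (addStrand n m) (kappa n i j) = kappa n i.castSucc j.castSucc :=
  Units.ext (congrArg (mk n) (addStrand_single i j 1))

/-- An arrow from the strand `j` to the last strand becomes a self-crossing under gluing, and may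
be deleted. -/
theorem glue_mul_kappa_mul {n m : ℕ} (j : Fin m) (p q : StringLink n (m + 1)) :
    glue j (p * (kappa n (Fin.last m) j.castSucc).val * q) = glue j (p * q) := by
  induction p using Quotient.inductionOn with | h P =>
  induction q using Quotient.inductionOn with | h Q =>
  have h1 : mk n P * mk n Q =
      mk n ((P.stack (trivialLink _)).stack Q) := by
    rw [mk_stack, mk_stack, mk_trivial, mul_one]
  change _ = glue j (mk n P * mk n Q)
  rw [h1]
  change mk n (((P.stack (single (Fin.last m) j.castSucc 1)).stack Q).glue j) =
    mk n (((P.stack (trivialLink _)).stack Q).glue j)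
  let M : MarkedStrands (m + 1) 2 := .two j.castSucc (Fin.last m)
    (fun c => ((P.strand c).map (ArrowEnd.relabel (2 * ·))).map (ArrowEnd.relabel (2 * ·)))
    (fun c => (Q.strand c).map (ArrowEnd.relabel (2 * · + 1)))
  have hM : ∀ (D : GaussDiagram (m + 1)) (x y : List ArrowEnd), D.strand = M.fill ![x, y] →
      (D.glue j).strand = ((glueTemplate j).plug id M).fill ![x, y] := by
    intro D x y h
    have := (glueTemplate j).plug_fill id M ![x, y]
    simp only [ArrowEnd.relabel_id, List.map_id] at this
    rw [this, ← h, glueTemplate_fill]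
    rfl
  refine sound (.rel _ _ (.inr (.inl ⟨(glueTemplate j).plug id M, ⟨2, 1⟩, j, ?_, ?_,
    hM _ _ _ ?_, hM _ _ _ ?_⟩)))
  · refine MarkedStrands.mem_plug (d := j.castSucc) _ _ _ ?_ ?_
    · simp [glueTemplate]
    · simp [M, MarkedStrands.two]
  · refine MarkedStrands.mem_plug (d := Fin.last m) _ _ _ ?_ ?_
    · simp [glueTemplate]
    · simp [M, MarkedStrands.two]
  · rw [MarkedStrands.two_fill]
    funext c
    simp [GaussDiagram.stack, single]
  · rw [MarkedStrands.two_fill]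
    funext c
    simp [GaussDiagram.stack, trivialLink, onStrand]

/-- The arrow comes last, and the glued strand comes after `j`: its tail is already where it should
be at the end of `j`, without any move. -/
theorem glue_addStrand_mul_kappa {n m : ℕ} {i j : Fin m} (hij : i ≠ j) (p : StringLink n m) :
    glue j (addStrand n m p * (kappa n i.castSucc (Fin.last m)).val) =
      p * (kappa n i j).val := by
  induction p using Quotient.inductionOn with | h P =>
  refine congrArg (mk n) (GaussDiagram.ext (funext fun c => ?_))
  have hi := (Fin.castSucc_lt_last i).ne
  rcases eq_or_ne c j with rfl | hc
  · simp [GaussDiagram.glue, GaussDiagram.addStrand, GaussDiagram.stack, single, onStrand, hi.symm,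
      hij.symm]
  · simp [GaussDiagram.glue, GaussDiagram.addStrand, GaussDiagram.stack, single, onStrand, hc]

/-- The classes of the diagrams without heads on the strand `j`. -/
def tailsOnly (n : ℕ) {m : ℕ} (j : Fin m) : Submonoid (StringLink n m) where
  carrier := {p | ∃ D, mk n D = p ∧ ∀ e ∈ D.strand j, ∃ a, e = .tail a}
  one_mem' := ⟨trivialLink m, rfl, by simp [trivialLink]⟩
  mul_mem' := by
    rintro _ _ ⟨D, rfl, hD⟩ ⟨E, rfl, hE⟩
    refine ⟨D.stack E, rfl, fun e he => ?_⟩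
    simp only [GaussDiagram.stack, List.mem_append, List.mem_map] at he
    rcases he with ⟨x, hx, rfl⟩ | ⟨x, hx, rfl⟩
    · obtain ⟨a, rfl⟩ := hD x hx
      exact ⟨_, rfl⟩
    · obtain ⟨a, rfl⟩ := hE x hx
      exact ⟨_, rfl⟩

theorem single_mem_tailsOnly (n : ℕ) {m : ℕ} {i j : Fin m} (hij : i ≠ j) (l : Fin m) (s : ℤˣ) :
    mk n (single i l s) ∈ tailsOnly n j := by
  refine ⟨_, rfl, fun e he => ?_⟩
  simp only [single, onStrand] at he
  split_ifs at he <;> simp_all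

/-- Here gluing puts the tail of the first arrow at the end of `j` instead of its beginning. As `j`
carries no heads, OC moves it back. -/
theorem glue_kappa_mul_addStrand {n m : ℕ} {i j : Fin m} (hij : i ≠ j) {p : StringLink n m}
    (hp : p ∈ tailsOnly n j) :
    glue j ((kappa n i.castSucc (Fin.last m)).val * addStrand n m p) =
      (kappa n i j).val * p := by
  obtain ⟨P, rfl, hP⟩ := hp
  have hi := (Fin.castSucc_lt_last i).ne
  refine sound (.perm_tails j (fun c hc => ?_) ?_ ?_)
  · simp [GaussDiagram.glue, GaussDiagram.addStrand, GaussDiagram.stack, single, onStrand, hc]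
  · simp [GaussDiagram.glue, GaussDiagram.addStrand, GaussDiagram.stack, single, onStrand, hi.symm,
      hij.symm]
  · intro e he
    simp [GaussDiagram.glue, GaussDiagram.addStrand, GaussDiagram.stack, single, onStrand, hi.symm,
      hij.symm] at he
    rcases he with ⟨x, hx, rfl⟩ | rfl
    · obtain ⟨a, rfl⟩ := hP x hx
      exact ⟨_, rfl⟩
    · exact ⟨_, rfl⟩

end StringLink

/-! ### Commutators and words in a free group -/

open scoped commutatorElement

/-- The commutator is the product of the commuting elements `x * y * x⁻¹` and `y⁻¹`, so the power is
taken factorwise. -/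
theorem commutator_pow {G : Type*} [Group G] {x y : G} (h : Commute (x * y * x⁻¹) y) (n : ℕ) :
    ⁅x, y⁆ ^ n = ⁅x, y ^ n⁆ := by
  rw [commutatorElement_def, commutatorElement_def, h.inv_right.mul_pow, conj_pow, inv_pow]

/-- The subgroup of the words in the letters of `S`. -/
def letters {α : Type*} (S : Set α) : Subgroup (FreeGroup α) :=
  Subgroup.closure (FreeGroup.of '' S)

theorem of_mem_letters {α : Type*} {S : Set α} {a : α} (ha : a ∈ S) :
    FreeGroup.of a ∈ letters S :=
  Subgroup.subset_closure ⟨a, ha, rfl⟩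

theorem letters_mono {α : Type*} {S T : Set α} (h : S ⊆ T) : letters S ≤ letters T :=
  Subgroup.closure_mono (Set.image_mono h)

theorem map_mem_letters {α β : Type*} (f : α → β) {S : Set α} {T : Set β}
    (h : ∀ a ∈ S, f a ∈ T) {w : FreeGroup α} (hw : w ∈ letters S) :
    FreeGroup.map f w ∈ letters T := by
  have : letters S ≤ (letters T).comap (FreeGroup.map f) := by
    refine (Subgroup.closure_le _).2 ?_
    rintro _ ⟨a, ha, rfl⟩
    simpa using of_mem_letters (h a ha)
  exact this hw

theorem commute_of_mem_letters {α G : Type*} [Group G] (f : FreeGroup α →* G) {S : Set α} {x : G}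
    (h : ∀ a ∈ S, Commute (f (.of a)) x) {w : FreeGroup α} (hw : w ∈ letters S) :
    Commute (f w) x := by
  have : letters S ≤ (Subgroup.centralizer {x}).comap f := by
    refine (Subgroup.closure_le _).2 ?_
    rintro _ ⟨a, ha, rfl⟩
    simpa [Subgroup.mem_centralizer_iff] using (h a ha).eq.symm
  exact (Subgroup.mem_centralizer_iff.1 (this hw) x rfl).symm

/-- The iterated commutator `[j₁, [j₂, ..., [j_{k-1}, j_k]]]`. -/
def iteratedCommutator {α : Type*} : List α → FreeGroup α
  | [] => 1
  | [j] => .of j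
  | j :: j' :: I => ⁅FreeGroup.of j, iteratedCommutator (j' :: I)⁆

theorem iteratedCommutator_mem {α : Type*} : (I : List α) →
    iteratedCommutator I ∈ letters {a | a ∈ I}
  | [] => one_mem _
  | [j] => of_mem_letters (by simp)
  | j :: j' :: I => by
    have h1 : FreeGroup.of j ∈ letters {a | a ∈ j :: j' :: I} := of_mem_letters (by simp)
    have h2 := letters_mono (fun a (ha : a ∈ j' :: I) => List.mem_cons_of_mem j ha)
      (iteratedCommutator_mem (j' :: I))
    exact mul_mem (mul_mem (mul_mem h1 h2) (inv_mem h1)) (inv_mem h2)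

/-! ### Relations between words spelled by heads, and powers of commutators -/

namespace StringLink

/-- The string link whose arrows have their heads on the strand `i`, where they spell a given
word. -/
def word (n : ℕ) {m : ℕ} (i : Fin m) : FreeGroup (Fin m) →* (StringLink n m)ˣ :=
  FreeGroup.lift (kappa n i)

@[simp] theorem word_of (n : ℕ) {m : ℕ} (i j : Fin m) : word n i (.of j) = kappa n i j :=
  FreeGroup.lift_apply_of

/-- Heads lie only on `i` and `l`, where there are no tails, and tails on a common strand commute.
-/
theorem commute_word_word (n : ℕ) {m : ℕ} {i l : Fin m} (hil : i ≠ l) {v w : FreeGroup (Fin m)}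
    (hv : v ∈ letters {j | j ≠ i ∧ j ≠ l}) (hw : w ∈ letters {j | j ≠ i ∧ j ≠ l}) :
    Commute (word n l v) (word n i w) := by
  refine commute_of_mem_letters _ (fun a ha => ?_) hv
  refine (commute_of_mem_letters _ (fun b hb => ?_) hw).symm
  rw [word_of, word_of]
  rcases eq_or_ne a b with rfl | hab
  · exact commute_kappa_tails n hb.1.symm hb.2.symm hil
  · exact commute_kappa_disjoint n hb.1.symm hil.symm hb.2.symm ha.1 hab

theorem commute_kappa_mul_kappa (n : ℕ) {m : ℕ} {i j l : Fin m} (hij : i ≠ j) (hlj : l ≠ j)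
    (hil : i ≠ l) : Commute (kappa n l j * kappa n i j) (kappa n i l) := by
  have h := kappa_r3 n hij hlj hil
  rwa [mul_assoc (kappa n i l), (commute_kappa_tails n hij hlj hil).eq] at h

/-- The words on the strands `i` and `l` together commute with the arrow from `l` to `i`. -/
theorem commute_word_mul_word (n : ℕ) {m : ℕ} {i l : Fin m} (hil : i ≠ l)
    {w : FreeGroup (Fin m)} (hw : w ∈ letters {j | j ≠ i ∧ j ≠ l}) :
    Commute (word n l w * word n i w) (kappa n i l) := by
  induction hw using Subgroup.closure_induction with
  | mem _ h =>
    obtain ⟨j, ⟨hi, hl⟩, rfl⟩ := h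
    rw [word_of, word_of]
    exact commute_kappa_mul_kappa n hi.symm hl.symm hil
  | one => simp
  | mul v w hv hw ihv ihw =>
    -- As the two words commute, the product of the word on `l` and the word on `i` is
    -- multiplicative in the word.
    have h : word n l (v * w) * word n i (v * w) =
        (word n l v * word n i v) * (word n l w * word n i w) := by
      rw [map_mul, map_mul, mul_assoc, mul_assoc, ← mul_assoc (word n l w),
        (commute_word_word n hil hw hv).eq]
      simp only [mul_assoc]
    rw [h]
    exact ihv.mul_left ihw
  | inv v hv ih =>
    have h : word n l v⁻¹ * word n i v⁻¹ = (word n l v * word n i v)⁻¹ := by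
      rw [(commute_word_word n hil hv hv).eq]
      simp
    rw [h]
    exact ih.inv_left

theorem word_mem_tailsOnly (n : ℕ) {m : ℕ} {i j : Fin m} (hij : i ≠ j) (w : FreeGroup (Fin m)) :
    (word n i w).val ∈ tailsOnly n j := by
  induction w using FreeGroup.induction_on with
  | C1 => simp
  | of l =>
    rw [word_of]
    exact single_mem_tailsOnly n hij l 1
  | inv_of l _ =>
    rw [map_inv, word_of]
    exact single_mem_tailsOnly n hij l (-1)
  | mul v w hv hw =>
    rw [map_mul, Units.val_mul]
    exact mul_mem hv hw

theorem addStrand_word (n : ℕ) {m : ℕ} (i : Fin m) (w : FreeGroup (Fin m)) :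
    Units.map (addStrand n m) (word n i w) = word n i.castSucc (FreeGroup.map Fin.castSucc w) := by
  have : (Units.map (addStrand n m)).comp (word n i) =
      (word n i.castSucc).comp (FreeGroup.map Fin.castSucc) := by
    ext1 j
    simp [addStrand_kappa]
  exact DFunLike.congr_fun this w

/-- A letter commutes with its conjugates. -/
theorem commute_kappa_conj (n : ℕ) {m : ℕ} {i j : Fin m} (hij : i ≠ j) {u : FreeGroup (Fin m)}
    (hu : u ∈ letters {l | l ≠ i ∧ l ≠ j}) :
    Commute (word n i (u * .of j * u⁻¹)) (kappa n i j) := by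
  -- The word `v` contains `j`, so `commute_word_mul_word` does not apply to the strands `i` and
  -- `j`. It does apply to `i` and an additional strand.
  set v := u * FreeGroup.of j * u⁻¹ with hv
  have hie : i.castSucc ≠ Fin.last m := (Fin.castSucc_lt_last i).ne
  have hv' : FreeGroup.map Fin.castSucc v ∈ letters {l | l ≠ i.castSucc ∧ l ≠ Fin.last m} := by
    refine map_mem_letters (S := {l | l ≠ i})
      (T := {l | l ≠ i.castSucc ∧ l ≠ Fin.last m}) _
      (fun l hl => ⟨fun h => hl (Fin.castSucc_injective m h), (Fin.castSucc_lt_last l).ne⟩) ?_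
    have hu' := letters_mono (S := {l | l ≠ i ∧ l ≠ j}) (T := {l | l ≠ i}) (fun l hl => hl.1) hu
    exact mul_mem (mul_mem hu' (of_mem_letters hij.symm)) (inv_mem hu')
  have hc := commute_word_mul_word n hie hv'
  rw [← addStrand_word] at hc
  set h := word n (Fin.last m) (FreeGroup.map Fin.castSucc u)
  set t := Units.map (addStrand n m) (word n i v)
  have hB : word n (Fin.last m) (FreeGroup.map Fin.castSucc v) =
      h * kappa n (Fin.last m) j.castSucc * h⁻¹ := by
    simp [hv, h]
  rw [hB] at hc
  -- On each side of `hc`, gluing deletes the arrow from `j` to the additional strand; then `h` and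
  -- `h⁻¹` cancel, leaving `t` and the arrow from the additional strand to `i`.
  have h1 := glue_mul_kappa_mul (n := n) j h.val (h⁻¹ * (t * kappa n i.castSucc (Fin.last m))).val
  have h2 := glue_mul_kappa_mul (n := n) j (kappa n i.castSucc (Fin.last m) * h).val (h⁻¹ * t).val
  have h3 := congrArg (fun x : (StringLink n (m + 1))ˣ => glue j x.val) hc.eq
  simp only [← Units.val_mul] at h1 h2 h3
  rw [show h * (h⁻¹ * (t * kappa n i.castSucc (Fin.last m))) =
    t * kappa n i.castSucc (Fin.last m) by group] at h1
  rw [show kappa n i.castSucc (Fin.last m) * h * (h⁻¹ * t) =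
    kappa n i.castSucc (Fin.last m) * t by group] at h2
  have h4 : glue j (t * kappa n i.castSucc (Fin.last m)).val =
      glue j (kappa n i.castSucc (Fin.last m) * t).val := by
    rw [← h1, ← h2]
    simpa only [mul_assoc] using h3
  refine Units.ext ?_
  rw [Units.val_mul, Units.val_mul, ← glue_addStrand_mul_kappa hij,
    ← glue_kappa_mul_addStrand hij (word_mem_tailsOnly n hij v)]
  exact h4

/-- Conjugation by `v⁻¹` reduces this to a letter and its conjugate by `v⁻¹ * u`. -/
theorem commute_conj_conj (n : ℕ) {m : ℕ} {i j : Fin m} (hij : i ≠ j) {u v : FreeGroup (Fin m)}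
    (hu : u ∈ letters {l | l ≠ i ∧ l ≠ j}) (hv : v ∈ letters {l | l ≠ i ∧ l ≠ j}) :
    Commute (word n i (u * .of j * u⁻¹)) (word n i (v * .of j * v⁻¹)) := by
  have h := commute_kappa_conj n hij (mul_mem (inv_mem hv) hu)
  simpa [mul_assoc] using (Commute.conj_iff (word n i v)).2 h

/-- An iterated commutator commutes with its conjugate by a letter which does not occur in it. -/
theorem commute_conj_iteratedCommutator (n : ℕ) {m : ℕ} {i l : Fin m} (hil : i ≠ l)
    {I : List (Fin m)} (hI : I ≠ []) (hl : l ∉ I) (hi : i ∉ I) (hn : I.Nodup) :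
    Commute (kappa n i l * word n i (iteratedCommutator I) * (kappa n i l)⁻¹)
      (word n i (iteratedCommutator I)) := by
  match I, hI with
  | [j], _ =>
    have hij : i ≠ j := fun h => hi (by simp [h])
    have hlj : l ≠ j := fun h => hl (by simp [h])
    simpa [iteratedCommutator] using
      commute_kappa_conj n hij (u := .of l) (of_mem_letters ⟨hil.symm, hlj⟩)
  | j :: j' :: I, _ =>
    have hij : i ≠ j := fun h => hi (by simp [h])
    have hlj : l ≠ j := fun h => hl (by simp [h])
    set c := iteratedCommutator (j' :: I)
    have hc : c ∈ letters {a | a ≠ i ∧ a ≠ j} := by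
      refine letters_mono (S := {a | a ∈ j' :: I}) (T := {a | a ≠ i ∧ a ≠ j})
        (fun a ha => ⟨?_, ?_⟩) (iteratedCommutator_mem (j' :: I))
      · rintro rfl
        exact hi (List.mem_cons_of_mem _ ha)
      · rintro rfl
        exact (List.nodup_cons.1 hn).1 ha
    have hl' : FreeGroup.of l ∈ letters {a | a ≠ i ∧ a ≠ j} :=
      of_mem_letters ⟨hil.symm, hlj⟩
    -- Both elements are quotients of conjugates of `j`: `[j, c]` is `j` times the inverse of its
    -- conjugate by `c`, and conjugation by `l` preserves this form. All four conjugates involved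
    -- commute.
    have h1 := commute_conj_conj n hij hl' (one_mem _)
    have h2 := commute_conj_conj n hij hl' hc
    have h3 := commute_conj_conj n hij (mul_mem hl' hc) (one_mem _)
    have h4 := commute_conj_conj n hij (mul_mem hl' hc) hc
    have h5 := (h1.mul_right h2.inv_right).mul_left (h3.mul_right h4.inv_right).inv_left
    have e1 : word n i (iteratedCommutator (j :: j' :: I)) =
        word n i (1 * .of j * 1⁻¹) * (word n i (c * .of j * c⁻¹))⁻¹ := by
      simp [iteratedCommutator, commutatorElement_def, c, mul_assoc]
    have e2 : kappa n i l * word n i (iteratedCommutator (j :: j' :: I)) * (kappa n i l)⁻¹ =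
        word n i (.of l * .of j * (.of l)⁻¹) *
          (word n i (.of l * c * .of j * (.of l * c)⁻¹))⁻¹ := by
      simp [iteratedCommutator, commutatorElement_def, c, mul_assoc]
    rw [e2, e1]
    exact h5

theorem commutator_kappa_pow (n : ℕ) {m : ℕ} {i j l : Fin m} (hij : i ≠ j) (hlj : l ≠ j)
    (hil : i ≠ l) : ⁅kappa n i l, kappa n i j⁆ ^ n = 1 := by
  have hay := commute_kappa_tails n hij hlj hil
  have hbx := commute_kappa_tails n hil hlj.symm hij
  have hx := commute_kappa_mul_kappa n hij hlj hil
  have hy := commute_kappa_mul_kappa n hil hlj.symm hij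
  have hA := kappa_mul_kappa_pow n hlj.symm
  have h1 : Commute (kappa n i j) (kappa n i l * kappa n i j * (kappa n i l)⁻¹) := by
    simpa using (commute_kappa_conj n hij (u := .of l) (of_mem_letters ⟨hil.symm, hlj⟩)).symm
  have h2 : Commute (kappa n i l) (kappa n i j * kappa n i l * (kappa n i j)⁻¹) := by
    simpa using
      (commute_kappa_conj n hil (u := .of j) (of_mem_letters ⟨hij.symm, hlj.symm⟩)).symm
  generalize kappa n i l = x at *
  generalize kappa n i j = y at *
  generalize kappa n l j = a at *
  generalize kappa n j l = b at *
  -- The product equals `(a * y) * (b * x)`. Each factor commutes with `x`, and likewise with `y`,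
  -- by R3 or OC.
  have hxA : Commute (a * b * (x * y)) x := by
    have e : a * b * (x * y) = a * y * (b * x) := by
      rw [mul_assoc, ← mul_assoc b, hy.eq]
      simp only [mul_assoc]
    rw [e]
    exact hx.mul_left (hbx.symm.mul_left (.refl x))
  have hyA : Commute (a * b * (x * y)) y := by
    have e : a * b * (x * y) = a * y * (b * x) := by
      rw [mul_assoc, ← mul_assoc b, hy.eq]
      simp only [mul_assoc]
    rw [e]
    exact (hay.symm.mul_left (.refl y)).mul_left hy
  have hAxy : Commute (a * b) (x * y) := by
    have h := (hxA.mul_right hyA).mul_left (Commute.refl (x * y)).inv_left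
    rwa [mul_inv_cancel_right] at h
  -- Since `a * b` and `x * y` commute and `(a * b) ^ n = 1`, the `n`-th power of their product is
  -- `(x * y) ^ n`.
  have hp : Commute ((x * y) ^ n) x := by
    have h := hxA.pow_left n
    rwa [hAxy.mul_pow, hA, one_mul] at h
  have hcx : Commute ⁅x, y⁆ x := by
    have h := (Commute.refl x).mul_left h2.symm.inv_left
    simpa [commutatorElement_def, mul_assoc] using h
  have hcy : Commute ⁅x, y⁆ y := h1.symm.mul_left (Commute.refl y).inv_left
  have e : x * (x * y) * x⁻¹ = ⁅x, y⁆ * (x * y) := by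
    rw [← mul_assoc ⁅x, y⁆, hcx.eq]
    simp [commutatorElement_def, mul_assoc]
  have hc : Commute (x * (x * y) * x⁻¹) (x * y) := by
    rw [e]
    exact (hcx.mul_right hcy).mul_left (.refl _)
  -- By `e`, `⁅x, x * y⁆ = ⁅x, y⁆`; its `n`-th power is `⁅x, (x * y) ^ n⁆`, which `hp` makes
  -- trivial.
  have h := commutator_pow hc n
  rw [commutatorElement_eq_one_iff_commute.2 hp.symm, commutatorElement_def, e,
    mul_inv_cancel_right] at h
  exact h

/-- The `n`-th powers of iterated commutators are trivial. -/
theorem word_iteratedCommutator_pow (n : ℕ) {m : ℕ} : ∀ (I : List (Fin m)) (i : Fin m),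
    i ∉ I → I.Nodup → 2 ≤ I.length → word n i (iteratedCommutator I) ^ n = 1
  | [], _, _, _, h => by simp at h
  | [_], _, _, _, h => by simp at h
  | [l, j], i, hi, hn, _ => by
    simp only [List.mem_cons, List.not_mem_nil, or_false, not_or] at hi
    have hlj : l ≠ j := by simpa using hn
    simpa [iteratedCommutator, map_commutatorElement] using
      commutator_kappa_pow n hi.2 hlj hi.1
  | l :: j :: j' :: I, i, hi, hn, _ => by
    rw [List.mem_cons, not_or] at hi
    rw [List.nodup_cons] at hn
    -- The induction changes the strand of the heads from `i` to `l`, which does not occur in the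
    -- rest of the sequence.
    have ih := word_iteratedCommutator_pow n (j :: j' :: I) l hn.1 hn.2 (by simp)
    have hc := commute_conj_iteratedCommutator n hi.1 (List.cons_ne_nil j (j' :: I)) hn.1 hi.2 hn.2
    have hw : iteratedCommutator (j :: j' :: I) ∈ letters {a | a ≠ i ∧ a ≠ l} := by
      refine letters_mono (S := {a | a ∈ j :: j' :: I}) (T := {a | a ≠ i ∧ a ≠ l})
        (fun a ha => ⟨?_, ?_⟩) (iteratedCommutator_mem (j :: j' :: I))
      · rintro rfl
        exact hi.2 ha
      · rintro rfl
        exact hn.1 ha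
    have h := (commute_word_mul_word n hi.1 hw).pow_left n
    rw [(commute_word_word n hi.1 hw hw).mul_pow, ih, one_mul] at h
    rw [iteratedCommutator, map_commutatorElement, word_of, commutator_pow hc,
      commutatorElement_eq_one_iff_commute]
    exact h.symm

/-! ### The expansion of the trees -/

/-- The element of the free group which is spelled by a word in signed letters. -/
def spell {P : Type} (w : List (P × ℤˣ)) : FreeGroup P :=
  (w.map fun x => FreeGroup.of x.1 ^ (x.2 : ℤ)).prod

theorem spell_append {P : Type} (v w : List (P × ℤˣ)) : spell (v ++ w) = spell v * spell w := by
  simp [spell]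

theorem spell_invWord {P : Type} (w : List (P × ℤˣ)) :
    spell (TreeShape.invWord w) = (spell w)⁻¹ := by
  simp [spell, TreeShape.invWord, List.prod_inv_reverse, Function.comp_def, List.map_reverse]

/-- The expansion of a vertex joining two subtrees spells the commutator of their words. -/
theorem spell_expand_comb {P : Type} : (I : List P) → (h : I ≠ []) →
    spell (comb I h).expand = iteratedCommutator I
  | [], h => absurd rfl h
  | [j], _ => by simp [comb, TreeShape.expand, spell, iteratedCommutator]
  | j :: j' :: I, _ => by
    rw [comb, TreeShape.expand, spell_append, spell_append, spell_append, spell_invWord,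
      spell_invWord, spell_expand_comb (j' :: I), iteratedCommutator, commutatorElement_def]
    simp [TreeShape.expand, spell]

theorem word_spell (n : ℕ) {m : ℕ} (i : Fin m) (w : List (Fin m × ℤˣ)) :
    word n i (spell w) = (w.map fun x => kappa n i x.1 ^ (x.2 : ℤ)).prod := by
  simp [spell, map_list_prod, Function.comp_def]

theorem mk_W (n : ℕ) {m k : ℕ} {i : Fin m} {I : List (Fin m)} (hk : 1 ≤ k) (hI : I ∈ S k i) :
    mk n (W hk hI) = word n i (iteratedCommutator I) := by
  rw [← spell_expand_comb I (ne_nil_of_mem_S hk hI), word_spell]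
  exact mk_surgery n _ i _ _

theorem mk_WInv (n : ℕ) {m k : ℕ} {i : Fin m} {I : List (Fin m)} (hk : 1 ≤ k) (hI : I ∈ S k i) :
    mk n (WInv hk hI) = (word n i (iteratedCommutator I))⁻¹.val := by
  rw [← spell_expand_comb I (ne_nil_of_mem_S hk hI), ← map_inv, ← spell_invWord, word_spell]
  exact mk_surgery n _ i (.twist _) _

end StringLink

end Welded

/-! ### Both signs of the exponent -/

theorem lemma5p3 (m n : ℕ) (hn : 0 < n) (ε : ℤˣ) (k : ℕ) (hk : 2 ≤ k) (i : Fin m)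
    (I : List (Fin m)) (hI : I ∈ Welded.S k i) :
    Welded.TwoNSvEquivalent n
      (Welded.WPow (le_trans one_le_two hk) hI ((ε : ℤ) * (n : ℤ)))
      (Welded.trivialLink m) := by
  have h := Welded.StringLink.word_iteratedCommutator_pow n I i hI.2.2.1 hI.2.1 (hI.1 ▸ hk)
  rw [← Welded.StringLink.mk_eq]
  rcases Int.units_eq_one_or ε with rfl | rfl
  · rw [Units.val_one, one_mul]
    change Welded.StringLink.mk n ((Welded.W _ hI).npow n) = _
    rw [Welded.StringLink.mk_npow, Welded.StringLink.mk_W, ← Units.val_pow_eq_pow_val, h]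
    rfl
  · obtain ⟨x, rfl⟩ := Nat.exists_eq_succ_of_ne_zero hn.ne'
    -- Positivity of the exponent puts the negative case into the `Int.negSucc` branch of `WPow`,
    -- with exactly `x + 1` factors.
    rw [show (((-1 : ℤˣ) : ℤ) * ((x.succ : ℕ) : ℤ)) = Int.negSucc x by
      rw [Int.negSucc_eq]; push_cast; ring]
    change Welded.StringLink.mk _ ((Welded.WInv _ hI).npow (x + 1)) = _
    rw [Welded.StringLink.mk_npow, Welded.StringLink.mk_WInv, ← Units.val_pow_eq_pow_val, inv_pow,
      h, inv_one]
    rfl
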